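/- **Model.** Let $A\subseteq\mathbb R$ be a measurable symmetric set ($A=-A$), and let $dx$ denote a reference measure on $\mathbb R$ that is invariant under $x\mapsto -x$ (Lebesgue measure for continuous outcomes, counting measure for discrete outcomes). Let $f:A\times\mathbb R\to[0,\infty)$, measurable in $x$, be *valid*: 1. $\int_A f(x;y)\,dx=1$ for all $y\in\mathbb R$; 2. $f(x;y)=f(-x;-y)$ for all $x\in A$, $y\in\mathbb R$; 3. for $x\in A$ with $x<0$, $f(x;\cdot)$ is decreasing and $f(x;y)\to0$ as $y\to\infty$; 4. $\sup_{y\in\mathbb R}f(x;y)<\infty$ for every $x\in A$. Assume also that $f$ is *strictly log-concave* in $y$: $f>0$, and for each $x\in A$ the function $y\mapsto\log f(x;y)$ is twice differentiable with $\frac{\partial^2}{\partial y^2}\log f(x;y)<0$ for all $y\in\mathbb R$. Put $g(x;y)=\frac{\partial}{\partial y}\log f(x;y)$ and $g_2=\frac{\partial g}{\partial y}$. Fix an integer $T\ge1$. For each $n$ let $p_n\in[0,1]$, and let $\mathbf u=\mathbf u^{(n)}\in\mathbb R^n$ be the true score vector, normalized by $u_1=0$. For $1\le i<j\le n$ the number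 of comparisons is $n_{ij}\sim\mathrm{Bin}(T,p_n)$, and the outcomes $X_{ij}^{(t)}$ ($1\le t\le n_{ij}$) have density (mass function) $f(\cdot\,;u_i-u_j)$. For each $n$ all these variables are independent (that is, the counts are independent and, given the counts, the outcomes are independent). The data for all $n$ live on one probability space, with arbitrary dependence between different $n$. The maximum likelihood estimator (MLE) $\hat{\mathbf u}=\hat{\mathbf u}^{(n)}$ is a maximizer over $\{\mathbf v\in\mathbb R^n: v_1=0\}$ of $$l(\mathbf v)=\sum_{1\le i<j\le n}\ \sum_{t=1}^{n_{ij}}\log f\big(X_{ij}^{(t)};v_i-v_j\big).$$ Let $M_n=\max_{i,j}|u_i-u_j|$ and $$C_n^{(2)}=\sup_{x\in A,\,|y|\le M_n}|g(x;y)|,\qquad C_n^{(3)}=\sup_{x\in A,\,|y|\le M_n+1}|g_2(x;y)|,\qquad C_n^{(4)}=\inf_{x\in A,\,|y|\le M_n+1}|g_2(x;y)|.$$ **Statement.** Suppose that $\sup_nM_n<\infty$, that $C_n^{(2)}<\infty$, $C_n^{(3)}<\infty$ and $C_n^{(4)}>0$ for every $n$, and that $p_n\gtrsim(\log n)^3/n$,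 i.e. there is a constant $K$ with $(\log n)^3/n\le Kp_n$ for all sufficiently large $n$. Then there is a (deterministic) constant $C$, independent of $n$, such that almost surely: for all but finitely many $n$ the MLE $\hat{\mathbf u}$ exists and is unique; it is uniformly consistent, $\|\hat{\mathbf u}-\mathbf u\|_\infty\to0$ as $n\to\infty$; and $$\|\hat{\mathbf u}-\mathbf u\|_\infty\le\frac{C}{\log\log n}\qquad\text{for all but finitely many }n.$$ -/

import Mathlib

open MeasureTheory ProbabilityTheory Filter Topology

noncomputable section

namespace PairwiseComparison

/-- `f : A × ℝ → ℝ` is a valid pairwise comparison model with outcome set `A ⊆ ℝ`. The measure `ν`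
is the one written `dx`: Lebesgue measure for a density, counting measure for a mass function.
Only the values `f x y` with `x ∈ A` matter. -/
structure IsValid (ν : Measure ℝ) (A : Set ℝ) (f : ℝ → ℝ → ℝ) : Prop where
  measurableSet : MeasurableSet A
  neg_mem : ∀ x ∈ A, -x ∈ A
  measurable : ∀ y, Measurable fun x : A => f x y
  nonneg : ∀ x ∈ A, ∀ y, 0 ≤ f x y
  integral_eq_one : ∀ y, ∫ x in A, f x y ∂ν = 1
  even : ∀ x ∈ A, ∀ y, f x y = f (-x) (-y)
  antitone : ∀ x ∈ A, x < 0 → Antitone (f x)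
  tendsto_zero : ∀ x ∈ A, x < 0 → Tendsto (f x) atTop (𝓝 0)
  bounded : ∀ x ∈ A, BddAbove (Set.range (f x))

/-- `g(x; y) = ∂/∂y log f(x; y)`. -/
def score (f : ℝ → ℝ → ℝ) (x y : ℝ) : ℝ := deriv (fun z => Real.log (f x z)) y

/-- `g₂(x; y) = ∂/∂y g(x; y)`. -/
def score₂ (f : ℝ → ℝ → ℝ) (x y : ℝ) : ℝ := deriv (score f x) y

/-- `f` is positive, and `log f(x; ·)` is twice differentiable with negative second derivative. -/
structure StrictlyLogConcave (A : Set ℝ) (f : ℝ → ℝ → ℝ) : Prop where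
  pos : ∀ x ∈ A, ∀ y, 0 < f x y
  differentiable_log : ∀ x ∈ A, Differentiable ℝ fun y => Real.log (f x y)
  differentiable_score : ∀ x ∈ A, Differentiable ℝ (score f x)
  score₂_neg : ∀ x ∈ A, ∀ y, score₂ f x y < 0

/-- `C⁽²⁾ = sup {|g(x; y)| : x ∈ A, |y| ≤ M}`, possibly infinite. -/
def C2 (A : Set ℝ) (f : ℝ → ℝ → ℝ) (M : ℝ) : ENNReal :=
  ⨆ (x : ℝ) (_ : x ∈ A) (y : ℝ) (_ : |y| ≤ M), ENNReal.ofReal |score f x y|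

/-- `C⁽³⁾ = sup {|g₂(x; y)| : x ∈ A, |y| ≤ M + 1}`, possibly infinite. -/
def C3 (A : Set ℝ) (f : ℝ → ℝ → ℝ) (M : ℝ) : ENNReal :=
  ⨆ (x : ℝ) (_ : x ∈ A) (y : ℝ) (_ : |y| ≤ M + 1), ENNReal.ofReal |score₂ f x y|

/-- `C⁽⁴⁾ = inf {|g₂(x; y)| : x ∈ A, |y| ≤ M + 1}`. -/
def C4 (A : Set ℝ) (f : ℝ → ℝ → ℝ) (M : ℝ) : ENNReal :=
  ⨅ (x : ℝ) (_ : x ∈ A) (y : ℝ) (_ : |y| ≤ M + 1), ENNReal.ofReal |score₂ f x y|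

/-- The dynamic range `max_{i,j} |u_i - u_j|` of a score vector. -/
def dynamicRange {n : ℕ} (u : Fin n → ℝ) : ℝ := ⨆ i, ⨆ j, |u i - u j|

/-- The law of one comparison outcome at relative score `y`: density `f(·; y)` on `A`. -/
def outcomeLaw (ν : Measure ℝ) (A : Set ℝ) (f : ℝ → ℝ → ℝ) (y : ℝ) : Measure ℝ :=
  (ν.restrict A).withDensity fun x => ENNReal.ofReal (f x y)

/-- The unordered pairs of subjects, listed as ordered pairs `i < j`. -/
abbrev Pairs (n : ℕ) : Type := {e : Fin n × Fin n // e.1 < e.2}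

/-- The data of the comparison model on `n` subjects with true scores `u`: for `i < j`,
`N i j` is the number of comparisons of `i` and `j`, with law `Bin(T, p)`, and `X i j t` is the
outcome of the `t`-th one, with density `f(·; u_i - u_j)`; only the outcomes with index
`t < N i j` are observed. All counts and all outcomes are independent. -/
structure IsComparisonData {Ω : Type*} [MeasurableSpace Ω] (P : Measure Ω) (ν : Measure ℝ)
    (A : Set ℝ) (f : ℝ → ℝ → ℝ) (T : ℕ) (p : unitInterval) {n : ℕ} (u : Fin n → ℝ)
    (N : Fin n → Fin n → Ω → ℕ) (X : Fin n → Fin n → Fin T → Ω → ℝ) : Prop where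
  count_law : ∀ i j, i < j → HasLaw (N i j) (binomial T p) P
  outcome_law : ∀ i j, i < j → ∀ t, HasLaw (X i j t) (outcomeLaw ν A f (u i - u j)) P
  indep : iIndepFun
    (Sum.elim (fun (e : Pairs n) (ω : Ω) => (N e.1.1 e.1.2 ω : ℝ))
      (fun (a : Pairs n × Fin T) (ω : Ω) => X a.1.1.1 a.1.1.2 a.2 ω)) P

/-- The conditional log-likelihood `l(v) = ∑_{i<j} ∑_{t ≤ n_ij} log f(X_ij^(t); v_i - v_j)` of
realized counts `N` and outcomes `X`. -/
def logLik (f : ℝ → ℝ → ℝ) {n T : ℕ} (N : Fin n → Fin n → ℕ) (X : Fin n → Fin n → Fin T → ℝ)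
    (v : Fin n → ℝ) : ℝ :=
  ∑ e : Pairs n, ∑ t ∈ Finset.univ.filter (fun t : Fin T => (t : ℕ) < N e.1.1 e.1.2),
    Real.log (f (X e.1.1 e.1.2 t) (v e.1.1 - v e.1.2))

/-- The normalized score vectors: those whose first coordinate is `0`. -/
def normalized (n : ℕ) : Set (Fin n → ℝ) := {v | ∀ i : Fin n, (i : ℕ) = 0 → v i = 0}

/-- `v` is a maximum likelihood estimator: it maximizes `l` over all vectors with `v_1 = 0`. -/
def IsMLE (f : ℝ → ℝ → ℝ) {n T : ℕ} (N : Fin n → Fin n → ℕ) (X : Fin n → Fin n → Fin T → ℝ)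
    (v : Fin n → ℝ) : Prop :=
  v ∈ normalized n ∧ ∀ w ∈ normalized n, logLik f N X w ≤ logLik f N X v

end PairwiseComparison

end

/-!
The log-likelihood is concave in the score vector, with curvature along each pair comparable to its
number of comparisons. Let `h` maximize it among the perturbations of `u` in a small box, and let
`U` be a superlevel set of `h`. Raising the scores of `U` from `u + h` lowered by `1 / log n` on `U`
back to `u + h` loses nothing, so by concavity raising `u` itself by `1 / log n` on `U` gains an
amount that grows with the number of comparisons leaving `U` and with the drop of `h` along them.
But at the truth no such move gains more than `3 log n · |U|`: a likelihood ratio has mean one, so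
Markov's inequality and a union bound over `U` apply. Since a subject has about `n p ≳ (log n)³`
comparisons, a drop of a large multiple of `1 / log n` along most of the boundary of `U` would gain
too much, so most of the boundary ends inside a slightly larger superlevel set. As the comparison
graph expands, each such step multiplies the size of the set by about `log n`, and after
`log n / log log n` steps it contains more than half of the subjects. The same holds from below, and
two majorities meet, so the oscillation of `h` is `O(1 / log log n)`. Hence `h`, shifted to be
normalized, is interior to the box and, by concavity, a global maximizer.
-/

noncomputable section

namespace PairwiseComparison

open scoped Finset

section Curvature

lemma add_le_add_of_concaveOn {E : Type*} [AddCommGroup E] [Module ℝ E] {s : Set E} {H : E → ℝ}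
    (hH : ConcaveOn ℝ s H) {x y z : E} (hx : x ∈ s) (hy : y ∈ s) (hz : z ∈ segment ℝ x y) :
    H x + H y ≤ H z + H (x + y - z) := by
  obtain ⟨a, b, ha, hb, hab, rfl⟩ := hz
  have hreflect : x + y - (a • x + b • y) = b • x + a • y := by
    rw [← eq_sub_iff_add_eq'] at hab
    subst hab
    module
  have h₁ := hH.2 hx hy ha hb hab
  have h₂ := hH.2 hx hy hb ha ((add_comm b a).trans hab)
  rw [hreflect]
  simp only [smul_eq_mul] at h₁ h₂
  linear_combination h₁ + h₂ - (H x + H y) * hab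

lemma concaveOn_sum {E ι : Type*} [AddCommGroup E] [Module ℝ E] {s : Set E} (hs : Convex ℝ s)
    {F : Finset ι} {φ : ι → E → ℝ} (h : ∀ t ∈ F, ConcaveOn ℝ s (φ t)) :
    ConcaveOn ℝ s fun z => ∑ t ∈ F, φ t z := by
  simpa only [Finset.sum_fn] using
    Finset.sum_induction φ (ConcaveOn ℝ s) (fun _ _ => ConcaveOn.add) (concaveOn_const 0 hs) h

/-- On `s`, the curvature `-φ''` lies between `c` and `C`. Stating this through concavity and
convexity makes it stable under sums and directly usable for finite differences. -/
structure CurvatureBoundedOn (s : Set ℝ) (c C : ℝ) (φ : ℝ → ℝ) : Prop where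
  concaveOn : ConcaveOn ℝ s fun z => φ z + c / 2 * z ^ 2
  convexOn : ConvexOn ℝ s fun z => φ z + C / 2 * z ^ 2

variable {s : Set ℝ} {c C : ℝ} {φ : ℝ → ℝ}

lemma CurvatureBoundedOn.of_hasDerivAt {φ' φ'' : ℝ → ℝ} (hs : Convex ℝ s)
    (hφ : ∀ z, HasDerivAt φ (φ' z) z) (hφ' : ∀ z, HasDerivAt φ' (φ'' z) z)
    (hc : ∀ z ∈ s, c ≤ -φ'' z) (hC : ∀ z ∈ s, -φ'' z ≤ C) : CurvatureBoundedOn s c C φ := by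
  have h₁ (b z : ℝ) : HasDerivAt (fun z => φ z + b / 2 * z ^ 2) (φ' z + b * z) z :=
    ((hφ z).fun_add ((hasDerivAt_pow 2 z).const_mul (b / 2))).congr_deriv (by push_cast; ring)
  have h₂ (b z : ℝ) : HasDerivAt (fun z => φ' z + b * z) (φ'' z + b) z := by
    simpa using (hφ' z).fun_add ((hasDerivAt_id z).const_mul b)
  have hcont (b : ℝ) : ContinuousOn (fun z => φ z + b / 2 * z ^ 2) s :=
    fun z _ => (h₁ b z).continuousAt.continuousWithinAt
  exact
    ⟨concaveOn_of_hasDerivWithinAt2_nonpos hs (hcont c) (fun z _ => (h₁ c z).hasDerivWithinAt)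
      (fun z _ => (h₂ c z).hasDerivWithinAt)
      fun z hz => by linarith [hc z (interior_subset hz)],
    convexOn_of_hasDerivWithinAt2_nonneg hs (hcont C) (fun z _ => (h₁ C z).hasDerivWithinAt)
      (fun z _ => (h₂ C z).hasDerivWithinAt)
      fun z hz => by linarith [hC z (interior_subset hz)]⟩

lemma CurvatureBoundedOn.sum {ι : Type*} {F : Finset ι} {φ : ι → ℝ → ℝ} (hs : Convex ℝ s)
    (h : ∀ t ∈ F, CurvatureBoundedOn s c C (φ t)) :
    CurvatureBoundedOn s (#F * c) (#F * C) fun z => ∑ t ∈ F, φ t z := by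
  have hsum (b z : ℝ) :
      ∑ t ∈ F, φ t z + #F * b / 2 * z ^ 2 = ∑ t ∈ F, (φ t z + b / 2 * z ^ 2) := by
    rw [Finset.sum_add_distrib, Finset.sum_const, nsmul_eq_mul]
    ring
  constructor
  · simp only [hsum]
    exact concaveOn_sum hs fun t ht => (h t ht).concaveOn
  · simp only [hsum]
    refine neg_concaveOn_iff.1 ?_
    simpa only [Pi.neg_def, ← Finset.sum_neg_distrib] using
      concaveOn_sum hs fun t ht => (h t ht).convexOn.neg

-- The four points `y`, `y + a`, `y + t - a`, `y + t` form a parallelogram; which diagonal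
-- is the outer one depends on whether `|a| ≤ |t|`.
lemma CurvatureBoundedOn.sub_le_sub_add (hφ : CurvatureBoundedOn s c C φ) (hcC : c ≤ C)
    {y t a : ℝ} (hta : 0 ≤ t * a) (hy : y ∈ s) (hya : y + a ∈ s) (hyt : y + t ∈ s)
    (hyta : y + t - a ∈ s) :
    φ (y + t) - φ (y + t - a) ≤ φ (y + a) - φ y + C * a ^ 2 - c * (t * a) := by
  rcases le_total |a| |t| with hat | hat
  · have hmem : y + a ∈ segment ℝ y (y + t) := by
      rw [segment_eq_uIcc, Set.mem_uIcc]
      rcases mul_nonneg_iff.1 hta with ⟨ht, ha⟩ | ⟨ht, ha⟩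
      · rw [abs_of_nonneg ha, abs_of_nonneg ht] at hat
        left; constructor <;> linarith
      · rw [abs_of_nonpos ha, abs_of_nonpos ht] at hat
        right; constructor <;> linarith
    have h := add_le_add_of_concaveOn hφ.concaveOn hy hyt hmem
    rw [show y + (y + t) - (y + a) = y + t - a by ring] at h
    linarith [mul_le_mul_of_nonneg_right hcC (sq_nonneg a)]
  · have hmem : y ∈ segment ℝ (y + a) (y + t - a) := by
      rw [segment_eq_uIcc, Set.mem_uIcc]
      rcases mul_nonneg_iff.1 hta with ⟨ht, ha⟩ | ⟨ht, ha⟩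
      · rw [abs_of_nonneg ha, abs_of_nonneg ht] at hat
        right; constructor <;> linarith
      · rw [abs_of_nonpos ha, abs_of_nonpos ht] at hat
        left; constructor <;> linarith
    have h := add_le_add_of_concaveOn hφ.convexOn.neg hya hyta hmem
    rw [show y + a + (y + t - a) - y = y + t by ring] at h
    simp only [Pi.neg_apply] at h
    linarith [mul_le_mul_of_nonneg_right hcC hta]

end Curvature

section Cut

variable {n : ℕ}

/-- The pairs with one endpoint in `U` and the other in `V`. -/
def pairsBetween (U V : Finset (Fin n)) : Finset (Pairs n) :=
  (U ×ˢ V ∪ V ×ˢ U).subtype fun x => x.1 < x.2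

lemma mem_pairsBetween {U V : Finset (Fin n)} {e : Pairs n} :
    e ∈ pairsBetween U V ↔ e.1.1 ∈ U ∧ e.1.2 ∈ V ∨ e.1.1 ∈ V ∧ e.1.2 ∈ U := by
  simp [pairsBetween]

lemma pairsBetween_comm (U V : Finset (Fin n)) : pairsBetween U V = pairsBetween V U := by
  rw [pairsBetween, Finset.union_comm, pairsBetween]

lemma card_pairsBetween {U V : Finset (Fin n)} (hUV : Disjoint U V) :
    #(pairsBetween U V) = #U * #V := by
  have hswap : #{x ∈ V ×ˢ U | x.1 < x.2} = #{x ∈ U ×ˢ V | ¬x.1 < x.2} := by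
    refine Finset.card_equiv (Equiv.prodComm _ _) fun x => ?_
    simp only [Finset.mem_filter, Finset.mem_product, Equiv.prodComm_apply, Prod.fst_swap,
      Prod.snd_swap, not_lt]
    refine ⟨fun h => ⟨h.1.symm, h.2.le⟩, fun h => ⟨h.1.symm, h.2.lt_of_ne ?_⟩⟩
    exact fun heq => Finset.disjoint_left.1 hUV h.1.1 (heq ▸ h.1.2)
  have hdisj : Disjoint {x ∈ U ×ˢ V | x.1 < x.2} {x ∈ V ×ˢ U | x.1 < x.2} :=
    Finset.disjoint_filter_filter (Finset.disjoint_product.2 (Or.inl hUV))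
  rw [pairsBetween, Finset.card_subtype, Finset.filter_union, Finset.card_union_of_disjoint hdisj,
    hswap, Finset.card_filter_add_card_filter_not, Finset.card_product]

/-- The total weight of the pairs between `U` and `V`. -/
def cut (k : Pairs n → ℝ) (U V : Finset (Fin n)) : ℝ := ∑ e ∈ pairsBetween U V, k e

lemma cut_comm (k : Pairs n → ℝ) (U V : Finset (Fin n)) : cut k U V = cut k V U := by
  rw [cut, pairsBetween_comm, cut]

/-- The graph with nonnegative edge weights `k` expands: the boundary of a set `U` of at most half
of the vertices has weight at least `α |U|`, even after a set `W` of at most `L |U|` vertices (and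
at most a quarter of all) is discarded; and no boundary has weight more than `β |U|`. -/
structure IsExpander (k : Pairs n → ℝ) (L α β : ℝ) : Prop where
  nonneg : ∀ e, 0 ≤ k e
  le_cut : ∀ U W : Finset (Fin n), U.Nonempty → 2 * #U ≤ n → 4 * #W ≤ n → (#W : ℝ) ≤ L * #U →
    α * #U ≤ cut k U (U ∪ W)ᶜ
  cut_le : ∀ U : Finset (Fin n), U.Nonempty → cut k U Uᶜ ≤ β * #U

lemma IsExpander.cut_compl_pos {k : Pairs n → ℝ} {L α β : ℝ} (hk : IsExpander k L α β)
    (hα : 0 < α) (hL : 0 ≤ L) {U : Finset (Fin n)} (hU : U.Nonempty) (hUc : Uᶜ.Nonempty) :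
    0 < cut k U Uᶜ := by
  have hhalf {V : Finset (Fin n)} (hV : V.Nonempty) (hVn : 2 * #V ≤ n) : 0 < cut k V Vᶜ := by
    have h := hk.le_cut V ∅ hV hVn (by simp) (by simpa using by positivity)
    rw [Finset.union_empty] at h
    have : 0 < #V := hV.card_pos
    exact lt_of_lt_of_le (by positivity) h
  rcases le_or_gt (2 * #U) n with hle | hlt
  · exact hhalf hU hle
  · have hcard := U.card_add_card_compl
    rw [Fintype.card_fin] at hcard
    have h := hhalf hUc (by lia)
    rwa [compl_compl, cut_comm] at h

end Cut

section PairSum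

variable {n : ℕ}

/-- The difference `v_i - v_j` of the scores of a pair. -/
def gap (e : Pairs n) : (Fin n → ℝ) →ₗ[ℝ] ℝ :=
  LinearMap.proj (R := ℝ) (φ := fun _ => ℝ) e.1.1 - LinearMap.proj (R := ℝ) (φ := fun _ => ℝ) e.1.2

lemma gap_apply (e : Pairs n) (v : Fin n → ℝ) : gap e v = v e.1.1 - v e.1.2 := rfl

/-- The objective with one term per pair, depending on the score difference. -/
def pairSum (ψ : Pairs n → ℝ → ℝ) (v : Fin n → ℝ) : ℝ := ∑ e, ψ e (gap e v)

lemma pairSum_add_const (ψ : Pairs n → ℝ → ℝ) (v : Fin n → ℝ) (b : ℝ) :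
    pairSum ψ (fun i => v i + b) = pairSum ψ v := by
  simp [pairSum, gap_apply]

lemma concaveOn_pairSum {ψ : Pairs n → ℝ → ℝ} (hψ : ∀ e, ConcaveOn ℝ Set.univ (ψ e)) :
    ConcaveOn ℝ Set.univ (pairSum ψ) :=
  concaveOn_sum convex_univ fun e _ => (hψ e).comp_linearMap (gap e)

lemma abs_gap_le (e : Pairs n) (v : Fin n → ℝ) : |gap e v| ≤ 2 * ‖v‖ := by
  rw [two_mul]
  exact (norm_sub_le _ _).trans (add_le_add (norm_le_pi_norm v _) (norm_le_pi_norm v _))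

-- Two distinct normalized vectors agree on a proper nonempty set of vertices, whose boundary
-- carries a strictly concave term on which their gaps differ.
lemma strictConcaveOn_pairSum_normalized {ψ : Pairs n → ℝ → ℝ} {k : Pairs n → ℝ}
    (hψ : ∀ e, ConcaveOn ℝ Set.univ (ψ e))
    (hψk : ∀ e, 0 < k e → StrictConcaveOn ℝ Set.univ (ψ e))
    (hcut : ∀ U : Finset (Fin n), U.Nonempty → Uᶜ.Nonempty → 0 < cut k U Uᶜ) :
    StrictConcaveOn ℝ (normalized n) (pairSum ψ) := by
  refine ⟨fun v hv w hw a b _ _ _ i hi => by simp [hv i hi, hw i hi],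
    fun v hv w hw hvw a b ha hb hab => ?_⟩
  obtain ⟨j, hj⟩ := Function.ne_iff.1 hvw
  let U : Finset (Fin n) := {i | v i = w i}
  have hU : U.Nonempty :=
    ⟨⟨0, j.pos⟩, by simp [U, hv ⟨0, j.pos⟩ rfl, hw ⟨0, j.pos⟩ rfl]⟩
  obtain ⟨e, heU, hke⟩ : ∃ e ∈ pairsBetween U Uᶜ, 0 < k e := by
    by_contra! hle
    exact (hcut U hU ⟨j, by simpa [U] using hj⟩).not_ge (Finset.sum_nonpos hle)
  have hgap : gap e v ≠ gap e w := by
    simp only [mem_pairsBetween, Finset.mem_compl, U, Finset.mem_filter_univ] at heU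
    rw [gap_apply, gap_apply]
    rcases heU with ⟨h₁, h₂⟩ | ⟨h₁, h₂⟩
    · exact fun h => h₂ (by linarith)
    · exact fun h => h₁ (by linarith)
  simp only [pairSum, Finset.smul_sum, ← Finset.sum_add_distrib, map_add, map_smul]
  exact Finset.sum_lt_sum (fun e _ => (hψ e).2 trivial trivial ha.le hb.le hab)
    ⟨e, Finset.mem_univ e, (hψk e hke).2 trivial trivial hgap ha hb hab⟩

end PairSum

section Chaining

variable {n : ℕ}

/-- The vector equal to `a` on `U` and to `0` elsewhere. -/
def bump (U : Finset (Fin n)) (a : ℝ) (i : Fin n) : ℝ := if i ∈ U then a else 0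

lemma sq_gap_bump (U : Finset (Fin n)) (a : ℝ) (e : Pairs n) :
    gap e (bump U a) ^ 2 = if e ∈ pairsBetween U Uᶜ then a ^ 2 else 0 := by
  by_cases h₁ : e.1.1 ∈ U <;> by_cases h₂ : e.1.2 ∈ U <;>
    simp [gap_apply, bump, mem_pairsBetween, h₁, h₂]

lemma abs_gap_bump_le (U : Finset (Fin n)) (a : ℝ) (e : Pairs n) : |gap e (bump U a)| ≤ |a| := by
  rw [← sq_le_sq, sq_gap_bump]
  split_ifs
  exacts [le_rfl, sq_nonneg a]

lemma gap_mul_gap_bump_nonneg {U : Finset (Fin n)} {a : ℝ} {h : Fin n → ℝ}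
    (hU : ∀ i ∈ U, ∀ j ∉ U, 0 ≤ a * (h i - h j)) (e : Pairs n) :
    0 ≤ gap e h * gap e (bump U a) := by
  by_cases h₁ : e.1.1 ∈ U <;> by_cases h₂ : e.1.2 ∈ U <;>
    simp only [gap_apply, bump, h₁, h₂, if_true, if_false] <;>
    first
    | linarith [hU _ h₁ _ h₂]
    | linarith [hU _ h₂ _ h₁]
    | simp

lemma le_gap_mul_gap_bump {U V : Finset (Fin n)} (hUV : Disjoint U V) {a θ : ℝ} {h : Fin n → ℝ}
    (hθ : ∀ i ∈ U, ∀ j ∈ V, θ ≤ a * (h i - h j)) {e : Pairs n} (he : e ∈ pairsBetween U V) :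
    θ ≤ gap e h * gap e (bump U a) := by
  have hV {j : Fin n} (hj : j ∈ V) : j ∉ U := Finset.disjoint_right.1 hUV hj
  rcases mem_pairsBetween.1 he with ⟨h₁, h₂⟩ | ⟨h₁, h₂⟩
  · simp only [gap_apply, bump, h₁, hV h₂, if_true, if_false]
    linarith [hθ _ h₁ _ h₂]
  · simp only [gap_apply, bump, h₂, hV h₁, if_true, if_false]
    linarith [hθ _ h₂ _ h₁]

lemma mul_cut_le_sum {k : Pairs n → ℝ} (hk : ∀ e, 0 ≤ k e) {U V : Finset (Fin n)}
    (hUV : Disjoint U V) {a θ : ℝ} {h : Fin n → ℝ}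
    (hU : ∀ i ∈ U, ∀ j ∉ U, 0 ≤ a * (h i - h j))
    (hθ : ∀ i ∈ U, ∀ j ∈ V, θ ≤ a * (h i - h j)) :
    θ * cut k U V ≤ ∑ e, k e * (gap e h * gap e (bump U a)) := by
  rw [cut, Finset.mul_sum]
  refine le_trans (Finset.sum_le_sum fun e he => ?_)
    (Finset.sum_le_univ_sum_of_nonneg fun e => mul_nonneg (hk e) (gap_mul_gap_bump_nonneg hU e))
  rw [mul_comm]
  exact mul_le_mul_of_nonneg_left (le_gap_mul_gap_bump hUV hθ he) (hk e)

lemma sum_mul_sq_gap_bump (k : Pairs n → ℝ) (U : Finset (Fin n)) (a : ℝ) :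
    ∑ e, k e * gap e (bump U a) ^ 2 = a ^ 2 * cut k U Uᶜ := by
  simp only [sq_gap_bump, mul_ite, mul_zero, Finset.sum_ite_mem, Finset.univ_inter, cut,
    Finset.mul_sum, mul_comm]

variable {ψ : Pairs n → ℝ → ℝ} {k : Pairs n → ℝ} {u h : Fin n → ℝ} {r c C a : ℝ}

-- At a maximizer `h`, lowering `h` by `a` on `U` gains nothing; curvature turns this into the
-- comparison with the gain at `u` itself.
lemma mul_cut_le_pairSum_bump_sub {θ : ℝ} {U V : Finset (Fin n)}
    (hψ : ∀ e, CurvatureBoundedOn (Metric.closedBall (gap e u) (2 * r)) (k e * c) (k e * C) (ψ e))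
    (hk : ∀ e, 0 ≤ k e) (hc : 0 ≤ c) (hcC : c ≤ C) (ha : |a| ≤ r)
    (hh : ‖h‖ ≤ r) (hha : ‖h - bump U a‖ ≤ r)
    (hmax : pairSum ψ (u + (h - bump U a)) ≤ pairSum ψ (u + h)) (hUV : Disjoint U V)
    (hU : ∀ i ∈ U, ∀ j ∉ U, 0 ≤ a * (h i - h j))
    (hθ : ∀ i ∈ U, ∀ j ∈ V, θ ≤ a * (h i - h j)) :
    c * θ * cut k U V ≤ pairSum ψ (u + bump U a) - pairSum ψ u + C * a ^ 2 * cut k U Uᶜ := by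
  have hball {w : Fin n → ℝ} {e : Pairs n} (hw : |gap e w| ≤ 2 * r) :
      gap e u + gap e w ∈ Metric.closedBall (gap e u) (2 * r) := by
    simpa [Real.dist_eq] using hw
  have hr : 0 ≤ r := (norm_nonneg h).trans hh
  have hedge (e : Pairs n) :
      c * (k e * (gap e h * gap e (bump U a))) ≤
        (ψ e (gap e (u + bump U a)) - ψ e (gap e u) + C * (k e * gap e (bump U a) ^ 2)) -
          (ψ e (gap e (u + h)) - ψ e (gap e (u + (h - bump U a)))) := by
    have hd := hball ((abs_gap_le e (h - bump U a)).trans (by linarith))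
    rw [map_sub, ← add_sub_assoc] at hd
    have := (hψ e).sub_le_sub_add (mul_le_mul_of_nonneg_left hcC (hk e))
      (gap_mul_gap_bump_nonneg hU e) (Metric.mem_closedBall_self (by linarith))
      (hball ((abs_gap_bump_le U a e).trans (by linarith)))
      (hball ((abs_gap_le e h).trans (by linarith))) hd
    simp only [map_add, map_sub, ← add_sub_assoc]
    linarith
  have hsum := Finset.sum_le_sum fun e (_ : e ∈ Finset.univ) => hedge e
  simp only [← Finset.mul_sum, Finset.sum_sub_distrib, Finset.sum_add_distrib,
    sum_mul_sq_gap_bump] at hsum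
  have hcut := mul_le_mul_of_nonneg_left (mul_cut_le_sum hk hUV hU hθ) hc
  simp only [pairSum] at hmax ⊢
  linarith

/-- Raising the scores of any nonempty set `U` of subjects by `±lam` raises the objective by at most
`γ |U|`. -/
def GainBounded (ψ : Pairs n → ℝ → ℝ) (u : Fin n → ℝ) (lam γ : ℝ) : Prop :=
  ∀ U : Finset (Fin n), U.Nonempty → ∀ a : ℝ, |a| = lam →
    pairSum ψ (u + bump U a) - pairSum ψ u ≤ γ * #U

/-- The superlevel set `{i | m ≤ g_i}`. -/
def superlevel (g : Fin n → ℝ) (m : ℝ) : Finset (Fin n) := {i | m ≤ g i}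

lemma mem_superlevel {g : Fin n → ℝ} {m : ℝ} {i : Fin n} : i ∈ superlevel g m ↔ m ≤ g i :=
  Finset.mem_filter_univ i

lemma superlevel_anti (g : Fin n → ℝ) : Antitone (superlevel g) := fun _ _ hm _ hi =>
  mem_superlevel.2 (hm.trans (mem_superlevel.1 hi))

lemma norm_sub_bump_superlevel_le (ha : a ≠ 0) (hh : ‖h‖ ≤ r) {m : ℝ}
    (hm : a ^ 2 - |a| * r ≤ m) : ‖h - bump (superlevel (a • h) m) a‖ ≤ r := by
  refine (pi_norm_le_iff_of_nonneg ((norm_nonneg h).trans hh)).2 fun i => ?_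
  have hi := (norm_le_pi_norm h i).trans hh
  rw [Real.norm_eq_abs] at hi ⊢
  by_cases hmem : i ∈ superlevel (a • h) m
  · simp only [Pi.sub_apply, bump, hmem, if_true]
    have hai : a ^ 2 - |a| * r ≤ a * h i := hm.trans (mem_superlevel.1 hmem)
    rw [abs_le] at hi ⊢
    rcases ha.lt_or_gt with hneg | hpos
    · rw [abs_of_neg hneg] at hai
      constructor <;> nlinarith
    · rw [abs_of_pos hpos] at hai
      constructor <;> nlinarith
  · simpa [bump, hmem] using hi

lemma IsExpander.superlevel_growth {L α β γ θ m lam : ℝ} (hexp : IsExpander k L α β)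
    (hψ : ∀ e, CurvatureBoundedOn (Metric.closedBall (gap e u) (2 * r)) (k e * c) (k e * C) (ψ e))
    (hc : 0 ≤ c) (hcC : c ≤ C) (hgain : GainBounded ψ u lam γ)
    (hh : h ∈ Metric.closedBall 0 r)
    (hmax : IsMaxOn (fun w => pairSum ψ (u + w)) (Metric.closedBall 0 r) h)
    (hlam : 0 < lam) (hlamr : lam ≤ r) (ha : |a| = lam) (hθ : 0 ≤ θ)
    (hm : lam ^ 2 - lam * r ≤ m) (hlt : γ + C * lam ^ 2 * β < c * θ * α)
    (hne : (superlevel (a • h) m).Nonempty) (hhalf : 2 * (#(superlevel (a • h) m) : ℝ) ≤ n) :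
    n < 4 * (#(superlevel (a • h) (m - θ)) - #(superlevel (a • h) m) : ℝ) ∨
      L * #(superlevel (a • h) m) <
        (#(superlevel (a • h) (m - θ)) - #(superlevel (a • h) m) : ℝ) := by
  subst ha
  rw [sq_abs] at hm hlt
  set U := superlevel (a • h) m
  set V := superlevel (a • h) (m - θ)
  have hUV : U ⊆ V := superlevel_anti _ (by linarith)
  have hdiff : (#(V \ U) : ℝ) = #V - #U := by
    rw [Finset.card_sdiff_of_subset hUV, Nat.cast_sub (Finset.card_le_card hUV)]
  by_contra! hsmall
  rw [← hdiff] at hsmall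
  have hlower := hexp.le_cut U (V \ U) hne (by exact_mod_cast hhalf)
    (by exact_mod_cast hsmall.1) hsmall.2
  rw [Finset.union_sdiff_of_subset hUV] at hlower
  have hshift := norm_sub_bump_superlevel_le (abs_pos.1 hlam) (mem_closedBall_zero_iff.1 hh) hm
  have hcut := mul_cut_le_pairSum_bump_sub (θ := θ) (U := U) (V := Vᶜ) hψ hexp.nonneg hc hcC hlamr
    (mem_closedBall_zero_iff.1 hh) hshift (hmax (mem_closedBall_zero_iff.2 hshift))
    (disjoint_compl_right.mono_left hUV)
    (fun i hi j hj => ?_) (fun i hi j hj => ?_)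
  · have hU : (0 : ℝ) < #U := by exact_mod_cast hne.card_pos
    have hC : 0 ≤ C * a ^ 2 := mul_nonneg (hc.trans hcC) (sq_nonneg a)
    have h₁ := mul_le_mul_of_nonneg_left hlower (mul_nonneg hc hθ)
    have h₂ := mul_le_mul_of_nonneg_left (hexp.cut_le U hne) hC
    have h₃ := mul_lt_mul_of_pos_right hlt hU
    linarith [hgain U hne a rfl]
  · have h₁ : m ≤ a * h i := mem_superlevel.1 hi
    have h₂ : ¬m ≤ a * h j := fun hle => hj (mem_superlevel.2 hle)
    linarith
  · have h₁ : m ≤ a * h i := mem_superlevel.1 hi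
    have h₂ : ¬m - θ ≤ a * h j := fun hle => Finset.mem_compl.1 hj (mem_superlevel.2 hle)
    linarith

lemma lt_two_mul_of_growth {s : ℕ → ℝ} (hs : Monotone s) (hs₀ : 1 ≤ s 0) {L b : ℝ} (hL : 1 ≤ L)
    {K : ℕ} (hgrow : ∀ j ≤ K, 2 * s j ≤ b → b < 4 * (s (j + 1) - s j) ∨ L * s j < s (j + 1) - s j)
    (hK : b ≤ L ^ K) : b < 2 * s (K + 1) := by
  by_contra! hle
  have hhalf {j : ℕ} (hj : j ≤ K) : 2 * s j ≤ b := by linarith [hs (Nat.le_succ_of_le hj)]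
  have hpos (j : ℕ) : 0 < s j := by linarith [hs (Nat.zero_le j)]
  have hdouble {j : ℕ} (hj : b < 4 * (s (j + 1) - s j) ∨ L * s j < s (j + 1) - s j) :
      b < 4 * (s (j + 1) - s j) ∨ 2 * s j < s (j + 1) :=
    hj.imp_right fun h => by linarith [le_mul_of_one_le_left (hpos j).le hL]
  have hinv (j : ℕ) (hj : j ≤ K) : b ≤ 4 * s j ∨ L ^ j ≤ s j := by
    induction j with
    | zero => exact Or.inr (by simpa using hs₀)
    | succ j ih =>
      have hstep := hgrow j (by lia) (hhalf (by lia))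
      rcases ih (by lia) with hquarter | hpow
      · rcases hdouble hstep with h | h <;> left <;> linarith [hpos j]
      · refine hstep.imp (fun h => by linarith [hpos j]) fun h => ?_
        rw [pow_succ']
        linarith [mul_le_mul_of_nonneg_left hpow (by linarith : 0 ≤ L), hpos j]
  have hquarter : b ≤ 4 * s K :=
    (hinv K le_rfl).elim id fun h => by linarith [hpos K]
  rcases hdouble (hgrow K le_rfl (hhalf le_rfl)) with h | h <;> linarith

lemma IsExpander.lt_two_mul_card_superlevel {L α β γ η lam : ℝ} (hexp : IsExpander k L α β)
    (hψ : ∀ e, CurvatureBoundedOn (Metric.closedBall (gap e u) (2 * r)) (k e * c) (k e * C) (ψ e))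
    (hc : 0 ≤ c) (hcC : c ≤ C) (hgain : GainBounded ψ u lam γ) (hh : h ∈ Metric.closedBall 0 r)
    (hmax : IsMaxOn (fun w => pairSum ψ (u + w)) (Metric.closedBall 0 r) h)
    (hlam : 0 < lam) (hlamr : lam ≤ r) (hlamη : lam ≤ η) (ha : |a| = lam)
    (hlt : γ + C * lam ^ 2 * β < c * (lam * η) * α) (hL : 1 ≤ L) {K : ℕ} (hK : (n : ℝ) ≤ L ^ K)
    (i : Fin n) : (n : ℝ) < 2 * #(superlevel (a • h) (a * h i - (K + 1) * (lam * η))) := by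
  have hθ : 0 ≤ lam * η := mul_nonneg hlam.le (hlam.le.trans hlamη)
  rcases le_or_gt (lam ^ 2 - lam * r) (a * h i - K * (lam * η)) with hroom | hlow
  · let s (j : ℕ) : ℝ := #(superlevel (a • h) (a * h i - j * (lam * η)))
    have hs : Monotone s := fun j j' hj => Nat.cast_le.2 <| Finset.card_le_card <|
      superlevel_anti _ <| sub_le_sub_left (mul_le_mul_of_nonneg_right (Nat.cast_le.2 hj) hθ) _
    have hmem (j : ℕ) : i ∈ superlevel (a • h) (a * h i - j * (lam * η)) :=
      mem_superlevel.2 (sub_le_self _ (mul_nonneg j.cast_nonneg hθ))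
    have hgrow := lt_two_mul_of_growth hs (Nat.one_le_cast.2 (Finset.card_pos.2 ⟨i, hmem 0⟩)) hL
      (fun j hj hhalf => ?_) hK
    · simpa only [s, Nat.cast_succ] using hgrow
    · have hjK : (j : ℝ) * (lam * η) ≤ K * (lam * η) :=
        mul_le_mul_of_nonneg_right (Nat.cast_le.2 hj) hθ
      have hstep := hexp.superlevel_growth hψ hc hcC hgain hh hmax hlam hlamr ha hθ
        (m := a * h i - j * (lam * η)) (by linarith) hlt ⟨i, hmem j⟩ hhalf
      rwa [sub_sub, ← add_one_mul, ← Nat.cast_succ] at hstep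
  · have huniv : superlevel (a • h) (a * h i - (K + 1) * (lam * η)) = Finset.univ := by
      refine Finset.eq_univ_of_forall fun l => mem_superlevel.2 ?_
      have hl : |a * h l| ≤ lam * r := by
        rw [abs_mul, ha]
        exact mul_le_mul_of_nonneg_left
          ((norm_le_pi_norm h l).trans (mem_closedBall_zero_iff.1 hh)) hlam.le
      have hsq : lam ^ 2 ≤ lam * η := by
        rw [sq]
        exact mul_le_mul_of_nonneg_left hlamη hlam.le
      exact le_trans (by linarith) (neg_le_of_abs_le hl)
    rw [huniv, Finset.card_univ, Fintype.card_fin]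
    have : (0 : ℝ) < n := Nat.cast_pos.2 i.pos
    linarith

-- More than half of the scores are not much below `h i`, and more than half are not much
-- above `h j`, so some score is both.
lemma IsExpander.sub_le_of_isMaxOn {L α β γ η lam : ℝ} (hexp : IsExpander k L α β)
    (hψ : ∀ e, CurvatureBoundedOn (Metric.closedBall (gap e u) (2 * r)) (k e * c) (k e * C) (ψ e))
    (hc : 0 ≤ c) (hcC : c ≤ C) (hgain : GainBounded ψ u lam γ) (hh : h ∈ Metric.closedBall 0 r)
    (hmax : IsMaxOn (fun w => pairSum ψ (u + w)) (Metric.closedBall 0 r) h)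
    (hlam : 0 < lam) (hlamr : lam ≤ r) (hlamη : lam ≤ η)
    (hlt : γ + C * lam ^ 2 * β < c * (lam * η) * α) (hL : 1 ≤ L) {K : ℕ} (hK : (n : ℝ) ≤ L ^ K)
    (i j : Fin n) : h i - h j ≤ 2 * (K + 1) * η := by
  have hmajority {a : ℝ} (ha : |a| = lam) :=
    hexp.lt_two_mul_card_superlevel hψ hc hcC hgain hh hmax hlam hlamr hlamη ha hlt hL hK
  have hi : n < 2 * #(superlevel (lam • h) (lam * h i - (K + 1) * (lam * η))) := by
    exact_mod_cast hmajority (abs_of_pos hlam) i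
  have hj : n < 2 * #(superlevel (-lam • h) (-lam * h j - (K + 1) * (lam * η))) := by
    exact_mod_cast hmajority ((abs_neg lam).trans (abs_of_pos hlam)) j
  obtain ⟨l, hl⟩ := Finset.inter_nonempty_of_card_lt_card_add_card
    (Finset.subset_univ (superlevel (lam • h) (lam * h i - (K + 1) * (lam * η))))
    (Finset.subset_univ (superlevel (-lam • h) (-lam * h j - (K + 1) * (lam * η))))
    (by rw [Finset.card_univ, Fintype.card_fin]; lia)
  have hil := mem_superlevel.1 (Finset.mem_inter.1 hl).1
  have hjl := mem_superlevel.1 (Finset.mem_inter.1 hl).2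
  simp only [Pi.smul_apply, smul_eq_mul] at hil hjl
  exact le_of_mul_le_mul_left (by linarith) hlam

-- A maximizer over the box around `u`, shifted to be normalized, lies in the interior of the box,
-- so by concavity it is a global maximizer.
lemma exists_normalized_max_near (hψ : ∀ e, ConcaveOn ℝ Set.univ (ψ e)) (hn : 0 < n)
    (hu : u ∈ normalized n) {δ : ℝ} (hδ : δ < r) (hr : 0 ≤ r)
    (hosc : ∀ h ∈ Metric.closedBall (0 : Fin n → ℝ) r,
      IsMaxOn (fun w => pairSum ψ (u + w)) (Metric.closedBall 0 r) h → ∀ i j, h i - h j ≤ δ) :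
    ∃ v ∈ normalized n, (∀ w, pairSum ψ w ≤ pairSum ψ v) ∧ ‖v - u‖ ≤ δ := by
  have hconc := concaveOn_pairSum hψ
  have hcont : Continuous (pairSum ψ) :=
    continuousOn_univ.1 (hconc.continuousOn isOpen_univ)
  obtain ⟨h, hh, hmax⟩ := (isCompact_closedBall (0 : Fin n → ℝ) r).exists_isMaxOn
    (Metric.nonempty_closedBall.2 hr) (hcont.comp (continuous_const_add u)).continuousOn
  let v (i : Fin n) : ℝ := (u + h) i + -h ⟨0, hn⟩
  have hv : pairSum ψ v = pairSum ψ (u + h) := pairSum_add_const ψ (u + h) _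
  have hvu : ‖v - u‖ ≤ δ := by
    have hδ₀ := (sub_self (h ⟨0, hn⟩)).ge.trans (hosc h hh hmax ⟨0, hn⟩ ⟨0, hn⟩)
    refine (pi_norm_le_iff_of_nonneg hδ₀).2 fun i => abs_le.2 ?_
    have h₁ := hosc h hh hmax i ⟨0, hn⟩
    have h₂ := hosc h hh hmax ⟨0, hn⟩ i
    simp only [v, Pi.sub_apply, Pi.add_apply]
    constructor <;> linarith
  have hlocal : IsLocalMax (pairSum ψ) v := by
    filter_upwards [Metric.ball_mem_nhds v (sub_pos.2 hδ)] with w hw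
    have hwu : ‖w - u‖ ≤ r := by
      linarith [norm_sub_le_norm_sub_add_norm_sub w v u, mem_ball_iff_norm.1 hw]
    have := hmax (mem_closedBall_zero_iff.2 hwu)
    simp only [Set.mem_ofPred_eq, Function.comp_apply, add_sub_cancel] at this
    exact this.trans hv.ge
  refine ⟨v, fun i hi => ?_, IsMaxOn.of_isLocalMax_of_convex_univ hlocal hconc, hvu⟩
  rw [show i = ⟨0, hn⟩ from Fin.ext hi]
  simp [v, hu ⟨0, hn⟩ rfl]

end Chaining

section MLE

variable {A : Set ℝ} {f : ℝ → ℝ → ℝ} {n T : ℕ} {N : Fin n → Fin n → ℕ}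
  {X : Fin n → Fin n → Fin T → ℝ}

/-- The indices of the observed comparisons of a pair. -/
def observed (T : ℕ) (N : Fin n → Fin n → ℕ) (e : Pairs n) : Finset (Fin T) :=
  {t | (t : ℕ) < N e.1.1 e.1.2}

/-- The number of observed comparisons of a pair, the edge weight of the comparison graph. -/
def weight (T : ℕ) (N : Fin n → Fin n → ℕ) (e : Pairs n) : ℝ := #(observed T N e)

/-- The contribution of one pair to the log-likelihood. -/
def pairLogLik (f : ℝ → ℝ → ℝ) (N : Fin n → Fin n → ℕ) (X : Fin n → Fin n → Fin T → ℝ)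
    (e : Pairs n) (y : ℝ) : ℝ :=
  ∑ t ∈ observed T N e, Real.log (f (X e.1.1 e.1.2 t) y)

lemma isMLE_iff {v : Fin n → ℝ} : IsMLE f N X v ↔
    v ∈ normalized n ∧ IsMaxOn (pairSum (pairLogLik f N X)) (normalized n) v := Iff.rfl

lemma StrictlyLogConcave.strictConcaveOn_log (hlc : StrictlyLogConcave A f) {x : ℝ} (hx : x ∈ A) :
    StrictConcaveOn ℝ Set.univ fun y => Real.log (f x y) :=
  strictConcaveOn_univ_of_deriv2_neg (hlc.differentiable_log x hx).continuous
    fun y => hlc.score₂_neg x hx y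

lemma StrictlyLogConcave.concaveOn_pairLogLik (hlc : StrictlyLogConcave A f)
    (hX : ∀ e : Pairs n, ∀ t, X e.1.1 e.1.2 t ∈ A) (e : Pairs n) :
    ConcaveOn ℝ Set.univ (pairLogLik f N X e) :=
  concaveOn_sum convex_univ fun t _ => (hlc.strictConcaveOn_log (hX e t)).concaveOn

lemma StrictlyLogConcave.strictConcaveOn_pairLogLik (hlc : StrictlyLogConcave A f)
    (hX : ∀ e : Pairs n, ∀ t, X e.1.1 e.1.2 t ∈ A) {e : Pairs n} (he : 0 < weight T N e) :
    StrictConcaveOn ℝ Set.univ (pairLogLik f N X e) := by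
  have hobs : (observed T N e).Nonempty := Finset.card_pos.1 (Nat.cast_pos.1 he)
  refine ⟨convex_univ, fun x _ y _ hxy a b ha hb hab => ?_⟩
  simp only [pairLogLik, Finset.smul_sum, ← Finset.sum_add_distrib]
  exact Finset.sum_lt_sum_of_nonempty hobs fun t _ =>
    (hlc.strictConcaveOn_log (hX e t)).2 trivial trivial hxy ha hb hab

lemma StrictlyLogConcave.curvatureBoundedOn_log (hlc : StrictlyLogConcave A f) {R c C x : ℝ}
    {s : Set ℝ} (hs : Convex ℝ s) (hsR : ∀ y ∈ s, |y| ≤ R) (hx : x ∈ A)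
    (hcurv : ∀ y, |y| ≤ R → -score₂ f x y ∈ Set.Icc c C) :
    CurvatureBoundedOn s c C fun y => Real.log (f x y) :=
  .of_hasDerivAt hs (fun y => (hlc.differentiable_log x hx y).hasDerivAt)
    (fun y => (hlc.differentiable_score x hx y).hasDerivAt)
    (fun y hy => (hcurv y (hsR y hy)).1) fun y hy => (hcurv y (hsR y hy)).2

lemma StrictlyLogConcave.curvatureBoundedOn_pairLogLik (hlc : StrictlyLogConcave A f)
    {R c C : ℝ} {s : Set ℝ} (hs : Convex ℝ s) (hsR : ∀ y ∈ s, |y| ≤ R)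
    (hcurv : ∀ x ∈ A, ∀ y, |y| ≤ R → -score₂ f x y ∈ Set.Icc c C)
    (hX : ∀ e : Pairs n, ∀ t, X e.1.1 e.1.2 t ∈ A) (e : Pairs n) :
    CurvatureBoundedOn s (weight T N e * c) (weight T N e * C) (pairLogLik f N X e) :=
  .sum hs fun t _ => hlc.curvatureBoundedOn_log hs hsR (hX e t) (hcurv _ (hX e t))

lemma IsExpander.isMLE_unique {L α β : ℝ} (hexp : IsExpander (weight T N) L α β)
    (hlc : StrictlyLogConcave A f) (hX : ∀ e : Pairs n, ∀ t, X e.1.1 e.1.2 t ∈ A)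
    (hα : 0 < α) (hL : 0 ≤ L) {v w : Fin n → ℝ} (hv : IsMLE f N X v) (hw : IsMLE f N X w) :
    v = w := by
  rw [isMLE_iff] at hv hw
  exact (strictConcaveOn_pairSum_normalized (hlc.concaveOn_pairLogLik hX)
    (fun _ he => hlc.strictConcaveOn_pairLogLik hX he)
    fun _ => hexp.cut_compl_pos hα hL).eq_of_isMaxOn hv.2 hw.2 hv.1 hw.1

lemma IsExpander.exists_isMLE_near {L α β γ c C r R η lam : ℝ} {u : Fin n → ℝ} {K : ℕ}
    (hexp : IsExpander (weight T N) L α β) (hlc : StrictlyLogConcave A f)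
    (hX : ∀ e : Pairs n, ∀ t, X e.1.1 e.1.2 t ∈ A)
    (hcurv : ∀ x ∈ A, ∀ y, |y| ≤ R → -score₂ f x y ∈ Set.Icc c C) (hc : 0 ≤ c) (hcC : c ≤ C)
    (hn : 0 < n) (hu : u ∈ normalized n) (huR : ∀ i j, |u i - u j| + 2 * r ≤ R)
    (hgain : GainBounded (pairLogLik f N X) u lam γ) (hlam : 0 < lam) (hlamη : lam ≤ η)
    (hlt : γ + C * lam ^ 2 * β < c * (lam * η) * α) (hL : 1 ≤ L) (hK : (n : ℝ) ≤ L ^ K)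
    (hr : 2 * (K + 1) * η < r) :
    ∃ v, IsMLE f N X v ∧ ‖v - u‖ ≤ 2 * (K + 1) * η := by
  have hη : η ≤ 2 * (K + 1) * η := by
    have : (0 : ℝ) ≤ K * η := mul_nonneg K.cast_nonneg (hlam.le.trans hlamη)
    linarith
  have hball (e : Pairs n) (y : ℝ) (hy : y ∈ Metric.closedBall (gap e u) (2 * r)) : |y| ≤ R := by
    have h₁ := abs_sub_abs_le_abs_sub y (gap e u)
    have h₂ := Metric.mem_closedBall.1 hy
    rw [Real.dist_eq] at h₂
    have h₃ := huR e.1.1 e.1.2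
    rw [← gap_apply] at h₃
    linarith
  obtain ⟨v, hv, hmax, hvu⟩ := exists_normalized_max_near (hlc.concaveOn_pairLogLik hX) hn hu hr
    (by linarith) fun h hh hmax => hexp.sub_le_of_isMaxOn
      (fun e => hlc.curvatureBoundedOn_pairLogLik (convex_closedBall _ _) (hball e) hcurv hX e)
      hc hcC hgain hh hmax hlam (by linarith) hlamη hlt hL hK
  exact ⟨v, isMLE_iff.2 ⟨hv, fun w _ => hmax w⟩, hvu⟩

end MLE

section Binomial

variable {Ω : Type*} [MeasurableSpace Ω] {P : Measure Ω} {T : ℕ} {p : unitInterval}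

lemma mgf_of_hasLaw_binomial {N : Ω → ℕ} (hN : HasLaw N (binomial T p) P) (ε : ℝ) :
    mgf (fun ω => (N ω : ℝ)) P ε = (p * Real.exp ε + (1 - p)) ^ T := by
  have hcomp := hN.integral_comp (f := fun k : ℕ => Real.exp (ε * k))
    Measurable.of_discrete.aestronglyMeasurable
  rw [mgf, show (fun ω => Real.exp (ε * N ω)) = (fun k : ℕ => Real.exp (ε * k)) ∘ N from rfl,
    hcomp, integral_binomial, add_pow, Nat.range_succ_eq_Iic]
  refine Finset.sum_congr rfl fun k _ => ?_
  rw [smul_eq_mul, mul_pow, mul_comm ε, Real.exp_nat_mul]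
  ring

lemma mgf_le_of_hasLaw_binomial {N : Ω → ℕ} (hN : HasLaw N (binomial T p) P) (ε : ℝ) :
    mgf (fun ω => (N ω : ℝ)) P ε ≤ Real.exp (T * p * (Real.exp ε - 1)) := by
  have hp₀ : 0 ≤ (p : ℝ) := p.2.1
  have hp₁ : (p : ℝ) ≤ 1 := p.2.2
  rw [mgf_of_hasLaw_binomial hN, mul_assoc, Real.exp_nat_mul]
  refine pow_le_pow_left₀ (by nlinarith [Real.exp_pos ε]) ?_ T
  linarith [Real.add_one_le_exp ((p : ℝ) * (Real.exp ε - 1))]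

lemma measureReal_le_sum_binomial {ι : Type*} {N : ι → Ω → ℕ}
    (hN : ∀ e, HasLaw (N e) (binomial T p) P) (hind : iIndepFun (fun e ω => (N e ω : ℝ)) P)
    (F : Finset ι) (ε θ : ℝ) :
    P.real {ω | θ ≤ ε * ∑ e ∈ F, (N e ω : ℝ)} ≤
      Real.exp (-θ + T * p * (Real.exp ε - 1) * #F) := by
  have : IsProbabilityMeasure P := hind.isProbabilityMeasure
  have hmeas (e : ι) : AEMeasurable (fun ω => (N e ω : ℝ)) P :=
    Measurable.of_discrete.comp_aemeasurable (hN e).aemeasurable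
  have hbdd : ∀ᵐ ω ∂P, ∑ e ∈ F, (N e ω : ℝ) ∈ Set.Icc 0 (#F * T : ℝ) := by
    filter_upwards [(Finset.eventually_all F).2 fun e _ => ae_le_of_hasLaw_binomial (hN e)]
      with ω hω
    refine ⟨Finset.sum_nonneg fun e _ => Nat.cast_nonneg _, ?_⟩
    rw [← nsmul_eq_mul]
    exact Finset.sum_le_card_nsmul _ _ _ fun e he => Nat.cast_le.2 (hω e he)
  have hint := integrable_exp_mul_of_mem_Icc (t := ε)
    (Finset.aemeasurable_fun_sum F fun e _ => hmeas e) hbdd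
  have hmgf : mgf (fun ω => ε * ∑ e ∈ F, (N e ω : ℝ)) P 1 ≤
      Real.exp (T * p * (Real.exp ε - 1) * #F) := by
    rw [mgf_const_mul, mul_one, mul_comm _ (#F : ℝ), Real.exp_nat_mul]
    have hsum := hind.mgf_sum₀ (t := ε) hmeas F
    rw [Finset.sum_fn] at hsum
    rw [hsum, ← Finset.prod_const]
    exact Finset.prod_le_prod (fun e _ => mgf_nonneg) fun e _ => mgf_le_of_hasLaw_binomial (hN e) ε
  refine (measure_ge_le_exp_mul_mgf θ zero_le_one (by simpa using hint)).trans ?_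
  rw [Real.exp_add, neg_one_mul]
  gcongr

end Binomial

section RandomSelection

lemma lintegral_prod_of_iIndepFun {Ω κ : Type*} [MeasurableSpace Ω] {P : Measure Ω}
    {Y : κ → Ω → ENNReal} (hY : iIndepFun Y P) (hm : ∀ a, AEMeasurable (Y a) P) (s : Finset κ) :
    ∫⁻ ω, ∏ a ∈ s, Y a ω ∂P = ∏ a ∈ s, ∫⁻ ω, Y a ω ∂P := by
  have h := lintegral_prod_eq_prod_lintegral_of_indepFun s
    (fun a => (hm a).mk (Y a)) (hY.congr fun a => (hm a).ae_eq_mk) fun a => (hm a).measurable_mk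
  rw [Finset.prod_congr rfl fun a _ => lintegral_congr_ae (hm a).ae_eq_mk, ← h]
  refine lintegral_congr_ae ?_
  filter_upwards [(Finset.eventually_all s).2 fun a _ => (hm a).ae_eq_mk] with ω hω
  exact Finset.prod_congr rfl hω

variable {Ω β κ 𝓧 : Type*} [MeasurableSpace Ω] [MeasurableSpace β] [MeasurableSpace 𝓧]
  [Finite κ] {P : Measure Ω} {N : Ω → β} {S : β → Finset κ} {X : κ → Ω → 𝓧}

lemma measurable_prod_mem (hS : ∀ a, MeasurableSet {b | a ∈ S b}) {g : κ → 𝓧 → ENNReal}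
    (hg : ∀ a, Measurable (g a)) :
    Measurable fun q : β × (κ → 𝓧) => ∏ a ∈ S q.1, g a (q.2 a) := by
  classical
  cases nonempty_fintype κ
  have hprod (q : β × (κ → 𝓧)) :
      ∏ a ∈ S q.1, g a (q.2 a) = ∏ a, if a ∈ S q.1 then g a (q.2 a) else 1 := by
    rw [Finset.prod_ite_mem, Finset.univ_inter]
  simp only [hprod]
  exact Finset.measurable_fun_prod _ fun a _ => Measurable.ite (measurable_fst (hS a))
    ((hg a).comp ((measurable_pi_apply a).comp measurable_snd)) measurable_const

-- Conditionally on the selection the product has mean one.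
lemma lintegral_prod_mem_eq_one (hN : AEMeasurable N P) (hX : ∀ a, AEMeasurable (X a) P)
    (hind : iIndepFun X P) (hNX : IndepFun N (fun ω a => X a ω) P)
    (hS : ∀ a, MeasurableSet {b | a ∈ S b}) {g : κ → 𝓧 → ENNReal} (hg : ∀ a, Measurable (g a))
    (hg₁ : ∀ a, ∫⁻ ω, g a (X a ω) ∂P = 1) :
    ∫⁻ ω, ∏ a ∈ S (N ω), g a (X a ω) ∂P = 1 := by
  have : IsProbabilityMeasure P := hind.isProbabilityMeasure
  have hXm : AEMeasurable (fun ω a => X a ω) P := aemeasurable_pi_iff.2 hX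
  have hgm := measurable_prod_mem hS hg
  have hcond (b : β) : ∫⁻ x, ∏ a ∈ S b, g a (x a) ∂(P.map fun ω a => X a ω) = 1 := by
    have hgb : Measurable fun x : κ → 𝓧 => ∏ a ∈ S b, g a (x a) := hgm.comp measurable_prodMk_left
    rw [lintegral_map' hgb.aemeasurable hXm]
    refine (lintegral_prod_of_iIndepFun (hind.comp g hg)
      (fun a => (hg a).comp_aemeasurable (hX a)) (S b)).trans ?_
    exact Finset.prod_eq_one fun a _ => hg₁ a
  have := Measure.isProbabilityMeasure_map hN (μ := P)
  rw [← lintegral_map' (f := fun q : β × (κ → 𝓧) => ∏ a ∈ S q.1, g a (q.2 a)) hgm.aemeasurable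
    (hN.prodMk hXm), (indepFun_iff_map_prod_eq_prod_map_map hN hXm).1 hNX,
    lintegral_prod _ hgm.aemeasurable]
  simp only [hcond, lintegral_one, measure_univ]

lemma measureReal_le_sum_mem (hN : AEMeasurable N P) (hX : ∀ a, AEMeasurable (X a) P)
    (hind : iIndepFun X P) (hNX : IndepFun N (fun ω a => X a ω) P)
    (hS : ∀ a, MeasurableSet {b | a ∈ S b}) {r : κ → 𝓧 → ℝ} (hr : ∀ a, Measurable (r a))
    (hr₁ : ∀ a, ∫⁻ ω, ENNReal.ofReal (Real.exp (r a (X a ω))) ∂P = 1) (θ : ℝ) :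
    P.real {ω | θ ≤ ∑ a ∈ S (N ω), r a (X a ω)} ≤ Real.exp (-θ) := by
  have hg (a : κ) : Measurable fun x => ENNReal.ofReal (Real.exp (r a x)) :=
    (hr a).exp.ennreal_ofReal
  have hone := lintegral_prod_mem_eq_one hN hX hind hNX hS hg hr₁
  have hmarkov := meas_ge_le_lintegral_div
    ((measurable_prod_mem hS hg).comp_aemeasurable (hN.prodMk (aemeasurable_pi_iff.2 hX)))
    (ENNReal.ofReal_pos.2 (Real.exp_pos θ)).ne' ENNReal.ofReal_ne_top
  simp only [Function.comp_def] at hmarkov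
  rw [hone, one_div, ← ENNReal.ofReal_inv_of_pos (Real.exp_pos _), ← Real.exp_neg] at hmarkov
  simp only [← ENNReal.ofReal_prod_of_nonneg fun _ _ => (Real.exp_pos _).le, ← Real.exp_sum,
    ENNReal.ofReal_le_ofReal_iff (Real.exp_pos _).le, Real.exp_le_exp] at hmarkov
  exact ENNReal.toReal_le_of_le_ofReal (Real.exp_pos _).le hmarkov

end RandomSelection

section Outcome

variable {ν : Measure ℝ} {A : Set ℝ} {f : ℝ → ℝ → ℝ}

/-- The part of `IsValid` that makes a positive `f(·; y)` a probability density on `A` for each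
`y`; neither symmetry nor monotonicity is assumed. -/
structure IsNormalized (ν : Measure ℝ) (A : Set ℝ) (f : ℝ → ℝ → ℝ) : Prop where
  measurableSet : MeasurableSet A
  measurable : ∀ y, Measurable fun x : A => f x y
  integral_eq_one : ∀ y, ∫ x in A, f x y ∂ν = 1

lemma IsValid.isNormalized (hf : IsValid ν A f) : IsNormalized ν A f :=
  ⟨hf.measurableSet, hf.measurable, hf.integral_eq_one⟩

lemma IsNormalized.ae_mem_outcomeLaw (hf : IsNormalized ν A f) (y : ℝ) :
    ∀ᵐ x ∂(outcomeLaw ν A f y), x ∈ A :=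
  (withDensity_absolutelyContinuous _ _).ae_le (ae_restrict_mem hf.measurableSet)

lemma IsNormalized.aemeasurable (hf : IsNormalized ν A f) (y : ℝ) :
    AEMeasurable (fun x => f x y) (ν.restrict A) :=
  (aemeasurable_restrict_iff_comap_subtype hf.measurableSet).2 (hf.measurable y).aemeasurable

lemma IsNormalized.lintegral_eq_one (hf : IsNormalized ν A f)
    (hlc : StrictlyLogConcave A f) (y : ℝ) : ∫⁻ x in A, ENNReal.ofReal (f x y) ∂ν = 1 := by
  have hint := hf.integral_eq_one y
  rw [← ofReal_integral_eq_lintegral_ofReal (integrable_of_integral_eq_one hint), hint,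
    ENNReal.ofReal_one]
  exact (ae_restrict_mem hf.measurableSet).mono fun x hx => (hlc.pos x hx y).le

/-- The log-likelihood ratio of `y'` against `y` at one outcome, extended by `0` outside `A`. -/
def logRatio (A : Set ℝ) (f : ℝ → ℝ → ℝ) (y' y : ℝ) : ℝ → ℝ :=
  A.indicator fun x => Real.log (f x y') - Real.log (f x y)

lemma IsNormalized.measurable_logRatio (hf : IsNormalized ν A f) (y' y : ℝ) :
    Measurable (logRatio A f y' y) := by
  refine measurable_of_restrict_of_restrict_compl hf.measurableSet ?_ ?_
  · convert (hf.measurable y').log.sub (hf.measurable y).log using 1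
    ext x
    simp [logRatio]
  · convert (measurable_const : Measurable fun _ : (Aᶜ : Set ℝ) => (0 : ℝ)) using 1
    ext x
    simp [logRatio, Set.indicator_of_notMem x.2]

lemma IsNormalized.lintegral_exp_logRatio (hf : IsNormalized ν A f)
    (hlc : StrictlyLogConcave A f) (y' y : ℝ) :
    ∫⁻ x, ENNReal.ofReal (Real.exp (logRatio A f y' y x)) ∂(outcomeLaw ν A f y) = 1 := by
  rw [outcomeLaw, lintegral_withDensity_eq_lintegral_mul₀ (hf.aemeasurable y).ennreal_ofReal
    (hf.measurable_logRatio y' y).exp.ennreal_ofReal.aemeasurable, ← hf.lintegral_eq_one hlc y']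
  refine lintegral_congr_ae ((ae_restrict_mem hf.measurableSet).mono fun x hx => ?_)
  have hy := hlc.pos x hx y
  simp only [Pi.mul_apply, logRatio, Set.indicator_of_mem hx]
  rw [← ENNReal.ofReal_mul hy.le, Real.exp_sub, Real.exp_log (hlc.pos x hx y'), Real.exp_log hy,
    mul_div_cancel₀ _ hy.ne']

end Outcome

section Tails

lemma indepFun_of_iIndepFun_sumElim {Ω ι κ 𝓧 : Type*} [MeasurableSpace Ω] [MeasurableSpace 𝓧]
    [Finite ι] [Finite κ] {P : Measure Ω} {Y : ι → Ω → 𝓧} {Z : κ → Ω → 𝓧}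
    (h : iIndepFun (Sum.elim Y Z) P) (hm : ∀ s, AEMeasurable (Sum.elim Y Z s) P) :
    IndepFun (fun ω i => Y i ω) (fun ω j => Z j ω) P := by
  cases nonempty_fintype ι
  cases nonempty_fintype κ
  have hdisj : Disjoint (Finset.univ.map .inl : Finset (ι ⊕ κ)) (Finset.univ.map .inr) :=
    Finset.disjoint_map_inl_map_inr _ _
  exact (h.indepFun_finset₀ _ _ hdisj hm).comp
    (φ := fun x i => x ⟨.inl i, by simp⟩) (ψ := fun x j => x ⟨.inr j, by simp⟩)
    (measurable_pi_lambda _ fun _ => measurable_pi_apply _)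
    (measurable_pi_lambda _ fun _ => measurable_pi_apply _)

variable {Ω : Type*} [MeasurableSpace Ω] {P : Measure Ω} {ν : Measure ℝ}
  {A : Set ℝ} {f : ℝ → ℝ → ℝ} {T : ℕ} {p : unitInterval} {n : ℕ} {u : Fin n → ℝ}
  {N : Fin n → Fin n → Ω → ℕ} {X : Fin n → Fin n → Fin T → Ω → ℝ}

lemma weight_eq_of_le {k : Fin n → Fin n → ℕ} {e : Pairs n} (hk : k e.1.1 e.1.2 ≤ T) :
    weight T k e = k e.1.1 e.1.2 := by
  rw [weight, observed, Fin.card_filter_val_lt, min_eq_right hk]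

lemma IsComparisonData.ae_mem (h : IsComparisonData P ν A f T p u N X)
    (hf : IsNormalized ν A f) :
    ∀ᵐ ω ∂P, ∀ e : Pairs n, ∀ t, X e.1.1 e.1.2 t ω ∈ A :=
  eventually_all.2 fun e => eventually_all.2 fun t =>
    ((h.outcome_law _ _ e.2 t).ae_iff hf.measurableSet.mem).2 (hf.ae_mem_outcomeLaw _)

lemma IsComparisonData.measureReal_le_cut (h : IsComparisonData P ν A f T p u N X)
    {U V : Finset (Fin n)} (hUV : Disjoint U V) (ε θ : ℝ) :
    P.real {ω | θ ≤ ε * cut (weight T fun i j => N i j ω) U V} ≤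
      Real.exp (-θ + T * p * (Real.exp ε - 1) * (#U * #V)) := by
  have : IsProbabilityMeasure P := h.indep.isProbabilityMeasure
  have hlaw (e : Pairs n) := h.count_law _ _ e.2
  have hcut : ∀ᵐ ω ∂P, cut (weight T fun i j => N i j ω) U V =
      ∑ e ∈ pairsBetween U V, (N e.1.1 e.1.2 ω : ℝ) := by
    filter_upwards [eventually_all.2 fun e => ae_le_of_hasLaw_binomial (hlaw e)] with ω hω
    exact Finset.sum_congr rfl fun e _ => weight_eq_of_le (k := fun i j => N i j ω) (hω e)
  have hchernoff := measureReal_le_sum_binomial hlaw (h.indep.precomp Sum.inl_injective)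
    (pairsBetween U V) ε θ
  rw [card_pairsBetween hUV, Nat.cast_mul] at hchernoff
  refine (ENNReal.toReal_mono (measure_ne_top _ _) (measure_mono_ae ?_)).trans hchernoff
  filter_upwards [hcut] with ω hω hθ
  exact (show θ ≤ _ from hθ).trans_eq (by rw [hω])

lemma pairSum_pairLogLik_sub {k : Fin n → Fin n → ℕ} {x : Fin n → Fin n → Fin T → ℝ}
    (hx : ∀ e : Pairs n, ∀ t, x e.1.1 e.1.2 t ∈ A) (w u : Fin n → ℝ) :
    pairSum (pairLogLik f k x) w - pairSum (pairLogLik f k x) u =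
      ∑ a : Pairs n × Fin T with (a.2 : ℝ) < k a.1.1.1 a.1.1.2,
        logRatio A f (gap a.1 w) (gap a.1 u) (x a.1.1.1 a.1.1.2 a.2) := by
  simp only [pairSum, pairLogLik, ← Finset.sum_sub_distrib]
  simp only [observed, Finset.sum_filter, Fintype.sum_prod_type, Nat.cast_lt, logRatio,
    Set.indicator_of_mem (hx _ _)]

lemma IsComparisonData.measureReal_le_pairSum_sub (h : IsComparisonData P ν A f T p u N X)
    (hf : IsNormalized ν A f) (hlc : StrictlyLogConcave A f) (w : Fin n → ℝ) (θ : ℝ) :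
    P.real {ω | θ ≤ pairSum (pairLogLik f (fun i j => N i j ω) fun i j t => X i j t ω) w -
      pairSum (pairLogLik f (fun i j => N i j ω) fun i j t => X i j t ω) u} ≤
      Real.exp (-θ) := by
  have hcount (e : Pairs n) : AEMeasurable (fun ω => (N e.1.1 e.1.2 ω : ℝ)) P :=
    Measurable.of_discrete.comp_aemeasurable (h.count_law _ _ e.2).aemeasurable
  have houtcome (a : Pairs n × Fin T) : AEMeasurable (X a.1.1.1 a.1.1.2 a.2) P :=
    (h.outcome_law _ _ a.1.2 a.2).aemeasurable
  have hratio (a : Pairs n × Fin T) :=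
    hf.measurable_logRatio (gap a.1 w) (gap a.1 u)
  have : IsProbabilityMeasure P := h.indep.isProbabilityMeasure
  refine (ENNReal.toReal_mono (measure_ne_top _ _) (measure_mono_ae ?_)).trans
    (measureReal_le_sum_mem (S := fun b => {a : Pairs n × Fin T | (a.2 : ℝ) < b a.1})
    (aemeasurable_pi_iff.2 hcount) houtcome (h.indep.precomp Sum.inr_injective)
    (indepFun_of_iIndepFun_sumElim h.indep (Sum.rec hcount houtcome)) (fun a => ?_) hratio
    (fun a => ?_) θ)
  · filter_upwards [h.ae_mem hf] with ω hω hθ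
    exact (show θ ≤ _ from hθ).trans_eq
      (pairSum_pairLogLik_sub (k := fun i j => N i j ω) (x := fun i j t => X i j t ω) hω w u)
  · simp only [Finset.mem_filter_univ]
    exact measurableSet_lt measurable_const (measurable_pi_apply _)
  · rw [(h.outcome_law _ _ a.1.2 a.2).lintegral_comp
      (hratio a).exp.ennreal_ofReal.aemeasurable]
    exact hf.lintegral_exp_logRatio hlc _ _

end Tails

section UnionBound

variable {Ω ι : Type*} [MeasurableSpace Ω] [Fintype ι] {P : Measure Ω}
  {q : Finset ι → Prop} {E : Finset ι → Ω → Prop} {a x : ℝ}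

lemma sum_pow_card (x : ℝ) : ∑ U : Finset ι, x ^ #U = (1 + x) ^ Fintype.card ι := by
  simpa only [one_pow, mul_one, add_comm] using Fintype.sum_pow_mul_eq_add_pow ι x 1

lemma measureReal_exists_le (ha : 0 ≤ a) (hx : 0 ≤ x)
    (hE : ∀ U, q U → P.real {ω | E U ω} ≤ a * x ^ #U) :
    P.real {ω | ∃ U, q U ∧ E U ω} ≤ a * (1 + x) ^ Fintype.card ι := by
  classical
  rw [← sum_pow_card, Finset.mul_sum,
    show {ω | ∃ U, q U ∧ E U ω} = ⋃ U ∈ Finset.univ.filter q, {ω | E U ω} by ext ω; simp]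
  refine (measureReal_biUnion_finset_le _ _).trans ((Finset.sum_le_sum fun U hU =>
    hE U (Finset.mem_filter.1 hU).2).trans ?_)
  exact Finset.sum_le_univ_sum_of_nonneg fun U => by positivity

lemma measureReal_exists_nonempty_le (ha : 0 ≤ a) (hx : 0 ≤ x) (hq : ∀ U, q U → U.Nonempty)
    (hE : ∀ U, q U → P.real {ω | E U ω} ≤ a * x ^ #U) :
    P.real {ω | ∃ U, q U ∧ E U ω} ≤ a * ((1 + x) ^ Fintype.card ι - 1) := by
  classical
  rw [← sum_pow_card, ← Finset.add_sum_erase _ _ (Finset.mem_univ ∅), Finset.card_empty, pow_zero,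
    add_sub_cancel_left, Finset.mul_sum,
    show {ω | ∃ U, q U ∧ E U ω} = ⋃ U ∈ Finset.univ.filter q, {ω | E U ω} by ext ω; simp]
  refine (measureReal_biUnion_finset_le _ _).trans ((Finset.sum_le_sum fun U hU =>
    hE U (Finset.mem_filter.1 hU).2).trans ?_)
  refine Finset.sum_le_sum_of_subset_of_nonneg (fun U hU => ?_) fun U _ _ => by positivity
  exact Finset.mem_erase.2 ⟨(hq U (Finset.mem_filter.1 hU).2).ne_empty, Finset.mem_univ U⟩

lemma ae_eventually_of_measureReal_le [IsFiniteMeasure P] {E : ℕ → Ω → Prop} {b : ℕ → ℝ}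
    (hb : Summable b) (h : ∀ᶠ n in atTop, P.real {ω | ¬ E n ω} ≤ b n) :
    ∀ᵐ ω ∂P, ∀ᶠ n in atTop, E n ω := by
  have hsum : Summable fun n => P.real {ω | ¬ E n ω} :=
    .of_norm_bounded_eventually_nat hb <| h.mono fun n hn => by
      rwa [Real.norm_of_nonneg measureReal_nonneg]
  have hfin : ∑' n, P {ω | ¬ E n ω} ≠ ⊤ := by
    simpa [ofReal_measureReal] using hsum.tsum_ofReal_ne_top
  exact (ae_eventually_notMem hfin).mono fun ω hω => hω.mono fun n hn => not_not.1 hn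

end UnionBound

section Events

variable {Ω : Type*} [MeasurableSpace Ω] {P : Measure Ω} {ν : Measure ℝ}
  {A : Set ℝ} {f : ℝ → ℝ → ℝ} {T : ℕ} {p : unitInterval} {n : ℕ} {u : Fin n → ℝ}
  {N : Fin n → Fin n → Ω → ℕ} {X : Fin n → Fin n → Fin T → Ω → ℝ} {κ L : ℝ}

lemma le_four_mul_card_compl_union {U W : Finset (Fin n)} (hU : 2 * #U ≤ n) (hW : 4 * #W ≤ n) :
    n ≤ 4 * #(U ∪ W)ᶜ := by
  have hunion := Finset.card_union_le U W
  have hcompl := Finset.card_add_card_compl (U ∪ W)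
  rw [Fintype.card_fin] at hcompl
  omega

lemma IsComparisonData.measureReal_cut_lt_le (h : IsComparisonData P ν A f T p u N X) (hT : 0 < T)
    (hκ : 0 ≤ κ) (hd : 16 * (1 + L) * κ ≤ n * p) {U W : Finset (Fin n)} (hU : 2 * #U ≤ n)
    (hW : 4 * #W ≤ n) (hWU : (#W : ℝ) ≤ L * #U) :
    P.real {ω | cut (weight T fun i j => N i j ω) U (U ∪ W)ᶜ < n * p / 16 * #U} ≤
      Real.exp (-κ) ^ #U * Real.exp (-κ) ^ #W := by
  have : IsProbabilityMeasure P := h.indep.isProbabilityMeasure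
  have hdisj : Disjoint U (U ∪ W)ᶜ :=
    disjoint_compl_right.mono_left Finset.subset_union_left
  refine (measureReal_mono fun ω hω => ?_).trans
    ((h.measureReal_le_cut hdisj (-1) (-(n * p / 16 * #U))).trans ?_)
  · exact (neg_le_neg (le_of_lt hω)).trans_eq (neg_one_mul (_ : ℝ)).symm
  · rw [← Real.exp_nat_mul, ← Real.exp_nat_mul, ← Real.exp_add, Real.exp_le_exp]
    have hcard : (n : ℝ) ≤ 4 * #(U ∪ W)ᶜ := by exact_mod_cast le_four_mul_card_compl_union hU hW
    have hexp : 1 / 2 ≤ 1 - Real.exp (-1) := by linarith [Real.exp_neg_one_lt_d9]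
    have hpT : (p : ℝ) ≤ T * p := le_mul_of_one_le_left p.2.1 (by exact_mod_cast hT)
    have hmean : (n : ℝ) * p / 8 * #U ≤
        T * p * (1 - Real.exp (-1)) * (#U * #(U ∪ W)ᶜ) := by
      calc (n : ℝ) * p / 8 * #U = p * (1 / 2) * (#U * (n / 4)) := by ring
        _ ≤ T * p * (1 - Real.exp (-1)) * (#U * #(U ∪ W)ᶜ) := by
          have hp := p.2.1
          gcongr
          linarith
    have hUW : κ * #U + κ * #W ≤ n * p / 16 * #U := by
      calc κ * #U + κ * #W ≤ κ * #U + κ * (L * #U) := by gcongr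
        _ = 16 * (1 + L) * κ / 16 * #U := by ring
        _ ≤ n * p / 16 * #U := by gcongr
    linarith

lemma IsComparisonData.measureReal_lt_cut_le (h : IsComparisonData P ν A f T p u N X)
    (hd : κ ≤ n * p) (U : Finset (Fin n)) :
    P.real {ω | (2 * T + 1) * (n * p : ℝ) * #U < cut (weight T fun i j => N i j ω) U Uᶜ} ≤
      Real.exp (-κ) ^ #U := by
  have : IsProbabilityMeasure P := h.indep.isProbabilityMeasure
  refine (measureReal_mono fun ω hω => ?_).trans ((h.measureReal_le_cut
    (disjoint_compl_right (a := U)) 1 ((2 * T + 1) * (n * p : ℝ) * #U)).trans ?_)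
  · exact (show (_ : ℝ) < _ from hω).le.trans_eq (one_mul (_ : ℝ)).symm
  · rw [← Real.exp_nat_mul, Real.exp_le_exp]
    have hexp : Real.exp 1 - 1 ≤ 2 := by linarith [Real.exp_one_lt_d9]
    have hcard : (#Uᶜ : ℝ) ≤ n := by exact_mod_cast card_finset_fin_le Uᶜ
    have hmean : (T : ℝ) * p * (Real.exp 1 - 1) * (#U * #Uᶜ) ≤ T * p * 2 * (#U * n) := by
      have hp := p.2.1
      gcongr
    have hU : κ * #U ≤ n * p * #U := by gcongr
    linarith

lemma IsComparisonData.measureReal_not_isExpander_le (h : IsComparisonData P ν A f T p u N X)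
    (hT : 0 < T) (hκ : 0 ≤ κ) (hL : 0 ≤ L) (hd : 16 * (1 + L) * κ ≤ n * p) :
    P.real {ω | ¬ IsExpander (weight T fun i j => N i j ω) L (n * p / 16)
      ((2 * T + 1) * (n * p))} ≤ (1 + Real.exp (-κ)) ^ (2 * n) - 1 := by
  have : IsProbabilityMeasure P := h.indep.isProbabilityMeasure
  have hx : 0 ≤ Real.exp (-κ) := (Real.exp_pos _).le
  set k : Ω → Pairs n → ℝ := fun ω => weight T fun i j => N i j ω
  have hsparse := measureReal_exists_nonempty_le (P := P) (a := (1 + Real.exp (-κ)) ^ n)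
    (q := fun U : Finset (Fin n) => U.Nonempty ∧ 2 * #U ≤ n)
    (E := fun U ω => ∃ W, (4 * #W ≤ n ∧ (#W : ℝ) ≤ L * #U) ∧
      cut (k ω) U (U ∪ W)ᶜ < n * p / 16 * #U) (by positivity) hx (fun U hU => hU.1) fun U hU => by
    have hW := measureReal_exists_le (P := P) (pow_nonneg hx #U) hx
      fun W (hW : 4 * #W ≤ n ∧ (#W : ℝ) ≤ L * #U) =>
        h.measureReal_cut_lt_le hT hκ hd hU.2 hW.1 hW.2
    rwa [Fintype.card_fin, mul_comm (_ ^ _)] at hW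
  have hdense := measureReal_exists_nonempty_le (P := P) (a := 1) (q := Finset.Nonempty)
    (E := fun U ω => (2 * T + 1) * (n * p : ℝ) * #U < cut (k ω) U Uᶜ) zero_le_one hx
    (fun _ => id) fun U _ => by
    rw [one_mul]
    exact h.measureReal_lt_cut_le (le_trans (by nlinarith) hd) U
  rw [Fintype.card_fin] at hsparse hdense
  refine (measureReal_mono fun ω hω => ?_).trans ((measureReal_union_le _ _).trans
    ((add_le_add hsparse hdense).trans_eq (by ring)))
  by_contra hgood
  simp only [Set.mem_union, Set.mem_ofPred_eq, not_or, not_exists, not_and, not_lt] at hgood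
  exact hω ⟨fun e => Nat.cast_nonneg _,
    fun U W hU hUn hWn hWU => hgood.1 U ⟨hU, hUn⟩ W ⟨hWn, hWU⟩, hgood.2⟩

lemma IsComparisonData.measureReal_not_gainBounded_le (h : IsComparisonData P ν A f T p u N X)
    (hf : IsNormalized ν A f) (hlc : StrictlyLogConcave A f) (lam γ : ℝ) :
    P.real {ω | ¬ GainBounded (pairLogLik f (fun i j => N i j ω) fun i j t => X i j t ω)
      u lam γ} ≤ (1 + Real.exp (-γ)) ^ (2 * n) - 1 := by
  have : IsProbabilityMeasure P := h.indep.isProbabilityMeasure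
  set l : Ω → (Fin n → ℝ) → ℝ := fun ω =>
    pairSum (pairLogLik f (fun i j => N i j ω) fun i j t => X i j t ω)
  have hgain (a : ℝ) := measureReal_exists_nonempty_le (P := P) (a := 1) (x := Real.exp (-γ))
    (q := Finset.Nonempty) (E := fun U ω => γ * #U ≤ l ω (u + bump U a) - l ω u) zero_le_one
    (Real.exp_pos _).le (fun _ => id) fun U _ => by
    rw [one_mul, ← Real.exp_nat_mul, mul_neg, mul_comm (#U : ℝ)]
    exact h.measureReal_le_pairSum_sub hf hlc (u + bump U a) (γ * #U)
  simp only [Fintype.card_fin] at hgain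
  refine (measureReal_mono fun ω hω => ?_).trans ((measureReal_union_le _ _).trans
    ((add_le_add (hgain lam) (hgain (-lam))).trans ?_))
  · by_contra hgood
    simp only [Set.mem_union, Set.mem_ofPred_eq, not_or, not_exists, not_and, not_le] at hgood
    refine hω fun U hU a ha => ?_
    obtain rfl | rfl := eq_or_eq_neg_of_abs_eq ha
    exacts [(hgood.1 U hU).le, (hgood.2 U hU).le]
  · have := sq_nonneg ((1 + Real.exp (-γ)) ^ n - 1)
    rw [mul_comm 2 n, pow_mul]
    linarith

end Events

section AlmostSure

variable {Ω : Type*} [MeasurableSpace Ω] {P : Measure Ω} {ν : Measure ℝ}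
  {A : Set ℝ} {f : ℝ → ℝ → ℝ} {T : ℕ} {p : ℕ → unitInterval} {u : (n : ℕ) → Fin n → ℝ}
  {N : (n : ℕ) → Fin n → Fin n → Ω → ℕ} {X : (n : ℕ) → Fin n → Fin n → Fin T → Ω → ℝ}

lemma one_add_exp_neg_log_pow_sub_one_le {n : ℕ} (hn : 2 ≤ n) :
    (1 + Real.exp (-(3 * Real.log n))) ^ (2 * n) - 1 ≤ 4 * ((n : ℝ) ^ 2)⁻¹ := by
  have hn₀ : (0 : ℝ) < n := by positivity
  have hexp : Real.exp (-(3 * Real.log n)) = ((n : ℝ) ^ 3)⁻¹ := by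
    rw [Real.exp_neg, ← Nat.cast_ofNat, Real.exp_nat_mul, Real.exp_log hn₀]
  set y : ℝ := 2 * ((n : ℝ) ^ 2)⁻¹ with hy
  have hy₀ : 0 ≤ y := by positivity
  have hy₁ : y ≤ 1 := by
    rw [hy, ← div_eq_mul_inv, div_le_one (by positivity)]
    have : (2 : ℝ) ≤ n := by exact_mod_cast hn
    nlinarith
  have hpow : (1 + ((n : ℝ) ^ 3)⁻¹) ^ (2 * n) ≤ Real.exp y := by
    calc (1 + ((n : ℝ) ^ 3)⁻¹) ^ (2 * n) ≤ Real.exp ((n : ℝ) ^ 3)⁻¹ ^ (2 * n) := by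
          gcongr
          linarith [Real.add_one_le_exp ((n : ℝ) ^ 3)⁻¹]
      _ = Real.exp y := by
          rw [← Real.exp_nat_mul, hy]
          congr 1
          push_cast
          field_simp
  have hlin := Real.abs_exp_sub_one_le (x := y) (by rwa [abs_of_nonneg hy₀])
  rw [abs_of_nonneg hy₀] at hlin
  rw [hexp]
  linarith [le_abs_self (Real.exp y - 1)]

lemma summable_four_mul_inv_sq : Summable fun n : ℕ => 4 * ((n : ℝ) ^ 2)⁻¹ :=
  (Real.summable_nat_pow_inv.2 one_lt_two).mul_left 4

lemma ae_eventually_isExpander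
    (hdata : ∀ n, IsComparisonData P ν A f T (p n) (u n) (N n) (X n)) (hT : 0 < T)
    (hp : ∀ᶠ n : ℕ in atTop, 16 * (1 + Real.log n) * (3 * Real.log n) ≤ n * p n) :
    ∀ᵐ ω ∂P, ∀ᶠ n : ℕ in atTop, IsExpander (weight T fun i j => N n i j ω) (Real.log n)
      (n * p n / 16) ((2 * T + 1) * (n * p n)) := by
  have : IsProbabilityMeasure P := (hdata 0).indep.isProbabilityMeasure
  refine ae_eventually_of_measureReal_le summable_four_mul_inv_sq ?_
  filter_upwards [hp, eventually_ge_atTop 2] with n hpn hn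
  have hlog := Real.log_natCast_nonneg n
  exact ((hdata n).measureReal_not_isExpander_le hT (by positivity) hlog hpn).trans
    (one_add_exp_neg_log_pow_sub_one_le hn)

lemma ae_eventually_gainBounded
    (hdata : ∀ n, IsComparisonData P ν A f T (p n) (u n) (N n) (X n))
    (hf : IsNormalized ν A f) (hlc : StrictlyLogConcave A f) (lam : ℕ → ℝ) :
    ∀ᵐ ω ∂P, ∀ᶠ n : ℕ in atTop,
      GainBounded (pairLogLik f (fun i j => N n i j ω) fun i j t => X n i j t ω) (u n) (lam n)
        (3 * Real.log n) := by
  have : IsProbabilityMeasure P := (hdata 0).indep.isProbabilityMeasure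
  refine ae_eventually_of_measureReal_le summable_four_mul_inv_sq ?_
  filter_upwards [eventually_ge_atTop 2] with n hn
  exact ((hdata n).measureReal_not_gainBounded_le hf hlc (lam n) _).trans
    (one_add_exp_neg_log_pow_sub_one_le hn)

end AlmostSure

section Rate

lemma two_mul_ceil_add_one_mul_le {ℓ B : ℝ} (hℓ : 1 < ℓ) (hB : 0 ≤ B) :
    2 * (⌈ℓ / Real.log ℓ⌉₊ + 1) * (B * ℓ⁻¹) ≤ 6 * B * (Real.log ℓ)⁻¹ := by
  have hℓ₀ : 0 < ℓ := by linarith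
  have hlog : 0 < Real.log ℓ := Real.log_pos hℓ
  have hinv : ℓ⁻¹ ≤ (Real.log ℓ)⁻¹ :=
    inv_anti₀ hlog ((Real.log_le_sub_one_of_pos hℓ₀).trans (by linarith))
  calc 2 * (⌈ℓ / Real.log ℓ⌉₊ + 1) * (B * ℓ⁻¹)
      ≤ 2 * (ℓ / Real.log ℓ + 1 + 1) * (B * ℓ⁻¹) := by
        gcongr
        exact (Nat.ceil_lt_add_one (by positivity)).le
    _ = 2 * B * (Real.log ℓ)⁻¹ + 4 * B * ℓ⁻¹ := by field_simp; ring
    _ ≤ 2 * B * (Real.log ℓ)⁻¹ + 4 * B * (Real.log ℓ)⁻¹ := by gcongr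
    _ = 6 * B * (Real.log ℓ)⁻¹ := by ring

lemma le_log_pow_ceil {x : ℝ} (hx : 0 < x) (hlog : 1 < Real.log x) :
    x ≤ Real.log x ^ ⌈Real.log x / Real.log (Real.log x)⌉₊ := by
  have hloglog : 0 < Real.log (Real.log x) := Real.log_pos hlog
  rw [← Real.log_le_log_iff hx (by positivity), Real.log_pow]
  exact (div_le_iff₀ hloglog).1 (Nat.le_ceil _)

lemma log_cube_gain_lt {ℓ d K C β c B : ℝ} (hℓ : 0 < ℓ) (hd : ℓ ^ 3 ≤ K * d) (hd₀ : 0 < d)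
    (hB : 16 * (3 * K + C * β) < c * B) :
    3 * ℓ + C * ℓ⁻¹ ^ 2 * (β * d) < c * (ℓ⁻¹ * (B * ℓ⁻¹)) * (d / 16) := by
  have hℓK : ℓ ≤ K * d * ℓ⁻¹ ^ 2 := by
    calc ℓ = ℓ ^ 3 * ℓ⁻¹ ^ 2 := by field_simp
      _ ≤ K * d * ℓ⁻¹ ^ 2 := by gcongr
  have hscaled := mul_lt_mul_of_pos_right hB (show 0 < d * ℓ⁻¹ ^ 2 by positivity)
  linarith

variable {A : Set ℝ} {f : ℝ → ℝ → ℝ} {n T : ℕ} {N : Fin n → Fin n → ℕ}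
  {X : Fin n → Fin n → Fin T → ℝ} {u : Fin n → ℝ} {r R c C β B K d : ℝ}

lemma IsExpander.existsUnique_isMLE_near
    (hexp : IsExpander (weight T N) (Real.log n) (d / 16) (β * d))
    (hgain : GainBounded (pairLogLik f N X) u (Real.log n)⁻¹ (3 * Real.log n))
    (hlc : StrictlyLogConcave A f) (hX : ∀ e : Pairs n, ∀ t, X e.1.1 e.1.2 t ∈ A)
    (hcurv : ∀ x ∈ A, ∀ y, |y| ≤ R → -score₂ f x y ∈ Set.Icc c C) (hc : 0 ≤ c) (hcC : c ≤ C)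
    (hu : u ∈ normalized n) (huR : ∀ i j, |u i - u j| + 2 * r ≤ R) (hn : 1 < Real.log n)
    (hd : Real.log n ^ 3 ≤ K * d) (hd₀ : 0 < d) (hB₁ : 1 ≤ B)
    (hB : 16 * (3 * K + C * β) < c * B) (hr : 6 * B * (Real.log (Real.log n))⁻¹ < r) :
    (∃! v, IsMLE f N X v) ∧
      ∀ v, IsMLE f N X v → ‖v - u‖ ≤ 6 * B * (Real.log (Real.log n))⁻¹ := by
  have hℓ : 0 < Real.log n := by linarith
  have hn₀ : n ≠ 0 := by
    rintro rfl
    simp at hℓ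
  have hrate := two_mul_ceil_add_one_mul_le hn (zero_le_one.trans hB₁)
  obtain ⟨v, hv, hvu⟩ := hexp.exists_isMLE_near hlc hX hcurv hc hcC hn₀.bot_lt hu huR hgain
    (inv_pos.2 hℓ) (le_mul_of_one_le_left (inv_pos.2 hℓ).le hB₁) (log_cube_gain_lt hℓ hd hd₀ hB)
    hn.le (le_log_pow_ceil (by positivity) hn) (hrate.trans_lt hr)
  have huniq (w) (hw : IsMLE f N X w) : w = v :=
    hexp.isMLE_unique hlc hX (by positivity) hℓ.le hw hv
  exact ⟨⟨v, hv, huniq⟩, fun w hw => huniq w hw ▸ hvu.trans hrate⟩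

lemma tendsto_log_natCast_atTop : Tendsto (fun n : ℕ => Real.log n) atTop atTop :=
  Real.tendsto_log_atTop.comp tendsto_natCast_atTop_atTop

lemma tendsto_mul_inv_log_log (a : ℝ) :
    Tendsto (fun n : ℕ => a * (Real.log (Real.log n))⁻¹) atTop (𝓝 0) := by
  simpa only [mul_zero, Function.comp_def] using (tendsto_inv_atTop_zero.comp
    (Real.tendsto_log_atTop.comp tendsto_log_natCast_atTop)).const_mul a

lemma exists_pos_eventually_log_cube_le {p : ℕ → unitInterval}
    (hp : ∃ K : ℝ, ∀ᶠ n : ℕ in atTop, Real.log n ^ 3 / n ≤ K * (p n : ℝ)) :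
    ∃ K : ℝ, 0 < K ∧ ∀ᶠ n : ℕ in atTop, Real.log n ^ 3 ≤ K * (n * p n) := by
  obtain ⟨K, hK⟩ := hp
  refine ⟨max K 1, by positivity, ?_⟩
  filter_upwards [hK, eventually_gt_atTop 0] with n hn hn₀
  rw [div_le_iff₀ (by exact_mod_cast hn₀)] at hn
  have hpn := (p n).2.1
  calc Real.log n ^ 3 ≤ K * p n * n := hn
    _ ≤ max K 1 * p n * n := by
      gcongr
      exact le_max_left K 1
    _ = max K 1 * (n * p n) := by ring

lemma eventually_log_sq_le {d : ℕ → ℝ} (hK : 0 < K)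
    (hd : ∀ᶠ n : ℕ in atTop, Real.log n ^ 3 ≤ K * d n) :
    ∀ᶠ n : ℕ in atTop, 16 * (1 + Real.log n) * (3 * Real.log n) ≤ d n := by
  filter_upwards [hd, tendsto_log_natCast_atTop.eventually_ge_atTop (max 1 (96 * K))] with n hdn hn
  obtain ⟨hn₁, hnK⟩ := max_le_iff.1 hn
  refine le_of_mul_le_mul_left ?_ hK
  calc K * (16 * (1 + Real.log n) * (3 * Real.log n))
      ≤ K * (16 * (Real.log n + Real.log n) * (3 * Real.log n)) := by gcongr
    _ = 96 * K * Real.log n ^ 2 := by ring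
    _ ≤ Real.log n * Real.log n ^ 2 := by gcongr
    _ ≤ K * d n := by linarith

end Rate

section CurvatureBounds

lemma abs_sub_le_dynamicRange {n : ℕ} (u : Fin n → ℝ) (i j : Fin n) :
    |u i - u j| ≤ dynamicRange u :=
  (le_ciSup (Set.finite_range fun j => |u i - u j|).bddAbove j).trans
    (le_ciSup (Set.finite_range fun i => ⨆ j, |u i - u j|).bddAbove i)

variable {A : Set ℝ} {f : ℝ → ℝ → ℝ}

lemma StrictlyLogConcave.neg_score₂_mem_Icc (hlc : StrictlyLogConcave A f) {M : ℝ}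
    {c C : NNReal} (hc : c ≤ C4 A f M) (hC : C3 A f M ≤ C) {x y : ℝ} (hx : x ∈ A)
    (hy : |y| ≤ M + 1) : -score₂ f x y ∈ Set.Icc (c : ℝ) C := by
  rw [← abs_of_neg (hlc.score₂_neg x hx y)]
  rw [← ENNReal.ofReal_coe_nnreal] at hc hC
  constructor
  · exact (ENNReal.ofReal_le_ofReal_iff (abs_nonneg _)).1
      (hc.trans (iInf₂_le_of_le x hx (iInf₂_le y hy)))
  · exact (ENNReal.ofReal_le_ofReal_iff C.2).1 (le_trans (le_iSup₂_of_le x hx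
      (le_iSup₂ (f := fun (y : ℝ) (_ : |y| ≤ M + 1) => ENNReal.ofReal |score₂ f x y|) y hy)) hC)

lemma StrictlyLogConcave.exists_neg_score₂_mem_Icc (hlc : StrictlyLogConcave A f)
    {u : (n : ℕ) → Fin n → ℝ} (hM : BddAbove (Set.range fun n => dynamicRange (u n)))
    (hC3 : ∀ n, C3 A f (dynamicRange (u n)) < ⊤) (hC4 : ∀ n, 0 < C4 A f (dynamicRange (u n))) :
    ∃ M R c C : ℝ, M < R ∧ 0 < c ∧ (∀ n i j, |u n i - u n j| ≤ M) ∧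
      ∀ x ∈ A, ∀ y, |y| ≤ R → -score₂ f x y ∈ Set.Icc c C := by
  set M : ℝ := ⨆ n, dynamicRange (u n)
  obtain ⟨m, hm⟩ : ∃ m, M - 1 / 2 < dynamicRange (u m) :=
    exists_lt_of_lt_ciSup (by linarith)
  obtain ⟨c, hc, hcC4⟩ := ENNReal.lt_iff_exists_nnreal_btwn.1 (hC4 m)
  obtain ⟨C, hC3C, -⟩ := ENNReal.lt_iff_exists_nnreal_btwn.1 (hC3 m)
  refine ⟨M, M + 1 / 2, c, C, by linarith, by exact_mod_cast hc,
    fun n i j => (abs_sub_le_dynamicRange _ i j).trans (le_ciSup hM n), fun x hx y hy => ?_⟩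
  exact hlc.neg_score₂_mem_Icc hcC4.le hC3C.le hx (by linarith)

end CurvatureBounds

section Estimator

variable {Ω : Type*} [MeasurableSpace Ω] {P : Measure Ω} {ν : Measure ℝ}
  {A : Set ℝ} {f : ℝ → ℝ → ℝ} {T : ℕ} {p : ℕ → unitInterval} {u : (n : ℕ) → Fin n → ℝ}
  {N : (n : ℕ) → Fin n → Fin n → Ω → ℕ} {X : (n : ℕ) → Fin n → Fin n → Fin T → Ω → ℝ}
  {M R c C : ℝ}

lemma exists_ae_eventually_existsUnique_isMLE_near
    (hdata : ∀ n, IsComparisonData P ν A f T (p n) (u n) (N n) (X n))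
    (hf : IsNormalized ν A f) (hlc : StrictlyLogConcave A f) (hT : 0 < T)
    (hu : ∀ n, u n ∈ normalized n) (hMR : M < R) (huM : ∀ n i j, |u n i - u n j| ≤ M)
    (hc : 0 < c) (hcC : c ≤ C)
    (hcurv : ∀ x ∈ A, ∀ y, |y| ≤ R → -score₂ f x y ∈ Set.Icc c C)
    (hp : ∃ K : ℝ, ∀ᶠ n : ℕ in atTop, Real.log n ^ 3 / n ≤ K * (p n : ℝ)) :
    ∃ D : ℝ, ∀ᵐ ω ∂P, ∀ᶠ n in atTop,
      (∃! v, IsMLE f (fun i j => N n i j ω) (fun i j t => X n i j t ω) v) ∧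
        ∀ v, IsMLE f (fun i j => N n i j ω) (fun i j t => X n i j t ω) v →
          ‖v - u n‖ ≤ D * (Real.log (Real.log n))⁻¹ := by
  obtain ⟨K, hK, hd⟩ := exists_pos_eventually_log_cube_le hp
  have hlogsq := eventually_log_sq_le hK hd
  obtain ⟨B, hB⟩ := exists_gt (max 1 (16 * (3 * K + C * (2 * T + 1)) / c))
  obtain ⟨hB₁, hBc⟩ := max_lt_iff.1 hB
  refine ⟨6 * B, ?_⟩
  filter_upwards [ae_eventually_isExpander hdata hT hlogsq,
    ae_eventually_gainBounded hdata hf hlc fun n => (Real.log n)⁻¹,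
    ae_all_iff.2 fun n => (hdata n).ae_mem hf] with ω hexp hgain hX
  filter_upwards [hexp, hgain, hd, hlogsq, tendsto_log_natCast_atTop.eventually_gt_atTop 1,
    (tendsto_mul_inv_log_log (6 * B)).eventually_lt_const (half_pos (sub_pos.2 hMR))]
    with n hexp hgain hd hlogsq hn hr
  exact hexp.existsUnique_isMLE_near hgain hlc (hX n) hcurv hc.le hcC (hu n)
    (fun i j => by linarith [huM n i j]) hn hd (lt_of_lt_of_le (by positivity) hlogsq) hB₁.le
    ((div_lt_iff₀' hc).1 hBc) hr

end Estimator

end PairwiseComparison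

end

theorem mainTheorem4_general
    (ν : Measure ℝ) (A : Set ℝ) (f : ℝ → ℝ → ℝ)
    (hf : PairwiseComparison.IsNormalized ν A f) (hlc : PairwiseComparison.StrictlyLogConcave A f)
    (T : ℕ) (hT : 0 < T) (p : ℕ → unitInterval)
    (u : (n : ℕ) → Fin n → ℝ) (hu : ∀ n, u n ∈ PairwiseComparison.normalized n)
    {M R c C : ℝ} (hMR : M < R) (huM : ∀ n i j, |u n i - u n j| ≤ M) (hc : 0 < c)
    (hcurv : ∀ x ∈ A, ∀ y, |y| ≤ R → -PairwiseComparison.score₂ f x y ∈ Set.Icc c C)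
    (hp : ∃ K : ℝ, ∀ᶠ n : ℕ in atTop, Real.log n ^ 3 / n ≤ K * (p n : ℝ))
    {Ω : Type*} [MeasurableSpace Ω] (P : Measure Ω)
    (N : (n : ℕ) → Fin n → Fin n → Ω → ℕ) (X : (n : ℕ) → Fin n → Fin n → Fin T → Ω → ℝ)
    (hdata : ∀ n, PairwiseComparison.IsComparisonData P ν A f T (p n) (u n) (N n) (X n)) :
    ∃ D : ℝ, ∀ᵐ ω ∂P,
      (∀ᶠ n in atTop, ∃! v : Fin n → ℝ,
        PairwiseComparison.IsMLE f (fun i j => N n i j ω) (fun i j t => X n i j t ω) v) ∧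
      ∀ uhat : (n : ℕ) → Fin n → ℝ,
        (∀ᶠ n in atTop, PairwiseComparison.IsMLE f
          (fun i j => N n i j ω) (fun i j t => X n i j t ω) (uhat n)) →
        Tendsto (fun n => ‖uhat n - u n‖) atTop (𝓝 0) ∧
        ∀ᶠ n : ℕ in atTop, ‖uhat n - u n‖ ≤ D * (Real.log (Real.log n))⁻¹ := by
  obtain ⟨D, hD⟩ := PairwiseComparison.exists_ae_eventually_existsUnique_isMLE_near hdata hf hlc hT
    hu hMR huM hc (le_max_left c C)
    (fun x hx y hy => Set.Icc_subset_Icc_right (le_max_right c C) (hcurv x hx y hy)) hp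
  refine ⟨D, hD.mono fun ω hω => ⟨hω.mono fun n hn => hn.1, fun uhat huhat => ?_⟩⟩
  have hbound : ∀ᶠ n : ℕ in atTop, ‖uhat n - u n‖ ≤ D * (Real.log (Real.log n))⁻¹ := by
    filter_upwards [hω, huhat] with n hn hv using hn.2 _ hv
  exact ⟨squeeze_zero' (.of_forall fun n => norm_nonneg _) hbound
    (PairwiseComparison.tendsto_mul_inv_log_log D), hbound⟩

theorem mainTheorem4
    (ν : Measure ℝ) [ν.IsNegInvariant] (A : Set ℝ) (f : ℝ → ℝ → ℝ)
    (hf : PairwiseComparison.IsValid ν A f) (hlc : PairwiseComparison.StrictlyLogConcave A f)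
    (T : ℕ) (hT : 0 < T) (p : ℕ → unitInterval)
    (u : (n : ℕ) → Fin n → ℝ) (hu : ∀ n, u n ∈ PairwiseComparison.normalized n)
    (hM : BddAbove (Set.range fun n => PairwiseComparison.dynamicRange (u n)))
    (hC2 : ∀ n, PairwiseComparison.C2 A f (PairwiseComparison.dynamicRange (u n)) < ⊤)
    (hC3 : ∀ n, PairwiseComparison.C3 A f (PairwiseComparison.dynamicRange (u n)) < ⊤)
    (hC4 : ∀ n, 0 < PairwiseComparison.C4 A f (PairwiseComparison.dynamicRange (u n)))
    (hp : ∃ K : ℝ, ∀ᶠ n : ℕ in atTop, Real.log n ^ 3 / n ≤ K * (p n : ℝ))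
    {Ω : Type*} [MeasurableSpace Ω] (P : Measure Ω) [IsProbabilityMeasure P]
    (N : (n : ℕ) → Fin n → Fin n → Ω → ℕ) (X : (n : ℕ) → Fin n → Fin n → Fin T → Ω → ℝ)
    (hdata : ∀ n, PairwiseComparison.IsComparisonData P ν A f T (p n) (u n) (N n) (X n)) :
    ∃ C : ℝ, ∀ᵐ ω ∂P,
      (∀ᶠ n in atTop, ∃! v : Fin n → ℝ,
        PairwiseComparison.IsMLE f (fun i j => N n i j ω) (fun i j t => X n i j t ω) v) ∧
      ∀ uhat : (n : ℕ) → Fin n → ℝ,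
        (∀ᶠ n in atTop, PairwiseComparison.IsMLE f
          (fun i j => N n i j ω) (fun i j t => X n i j t ω) (uhat n)) →
        Tendsto (fun n => ‖uhat n - u n‖) atTop (𝓝 0) ∧
        ∀ᶠ n : ℕ in atTop, ‖uhat n - u n‖ ≤ C * (Real.log (Real.log n))⁻¹ := by
  obtain ⟨M, R, c, C, hMR, hc, huM, hcurv⟩ := hlc.exists_neg_score₂_mem_Icc hM hC3 hC4
  exact mainTheorem4_general ν A f hf.isNormalized hlc T hT p u hu hMR huM hc hcurv hp P N X hdata
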